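/- Let $l,k,p,q$ be positive integers with $l<k$, $p<q$ and $l/k\neq p/q$, and let $t>0$. For $0<\alpha<1$ let $$v_\alpha(t,x)=\frac{1}{2\pi}\,\mathrm{Re}\int_{-\infty}^{\infty}e^{-i\omega x}\exp\!\big(-t|\omega|^{\alpha}e^{-\frac{i\pi}{2}\alpha\,\mathrm{sgn}\,\omega}\big)\,d\omega$$ be the one-sided $\alpha$-stable density, and let $$h(t,x)=h_{l/k,p/q}(t,x)=\int_0^x v_{l/k}(t,y)\,v_{p/q}(t,x-y)\,dy .$$ Put $m=\min(l/k,p/q)$, $M=\max(l/k,p/q)$, $m_1=\min(kp,lq)$ and $\kappa=\kappa(t,x)=\frac{(lp)^{lp}}{m_1^{m_1}}\big(t^{1/M}/x\big)^{lp}$. For $r\ge 0$ and $0\le n<m_1$ let $$T_{r,n}(t,x)=-\frac1\pi\,\frac{(-t)^{n+r}}{n!\,r!}\,\frac{\Gamma(1+Mn+mr)}{x^{1+Mn+mr}}\,\sin(\pi Mn+\pi mr)\;{}_{1+lp}F_{m_1}\!\left({1,\ \Delta(lp,1+Mn+mr)\atop \Delta(m_1,1+n)};(-1)^{m_1-lp}\kappa\right),$$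 where $\Delta(N,a)=\{\frac aN,\frac{a+1}N,\dots,\frac{a+N-1}N\}$ and ${}_PF_Q$ is the generalized hypergeometric series. (a) For every $x>0$, each of these hypergeometric series converges absolutely, the series $\sum_{r=0}^\infty\sum_{n=0}^{m_1-1}T_{r,n}(t,x)$ converges absolutely, its sum is $h(t,x)$, and $|h(t,x)|\le\sum_{r=0}^\infty\sum_{n=0}^{m_1-1}|T_{r,n}(t,x)|<\infty$. (b) $m_1-lp>0$, and there is a constant $B>0$ (depending on $l,k,p,q,t$ only) such that for all sufficiently small $x>0$ $$|h(t,x)|<B\,\kappa^{5/2}\,e^{-A\,\kappa^{1/(m_1-lp)}},\qquad A=m_1-lp .$$ (c) $h(t,x)\to0$ as $x\to0^+$. -/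

import Mathlib

namespace TwoScale

noncomputable section

open Real

/-- Characteristic function `exp (-t |ω|^α e^{(iπ/2) β sgn ω})` of the stable law with index `α`
and asymmetry parameter `β` at time `t`. -/
def stableCharFun (α β t ω : ℝ) : ℂ :=
  Complex.exp (-(t : ℂ) * ((|ω| ^ α : ℝ) : ℂ) *
    Complex.exp (Complex.I * ((π / 2 * β * SignType.sign ω : ℝ) : ℂ)))

/-- The stable density, the inverse Fourier transform
`(1 / 2π) ∫ e^{-iωx} exp (-t |ω|^α e^{(iπ/2) β sgn ω}) dω` of its characteristic function
(the integral is real since the integrand at `-ω` is the conjugate of the integrand at `ω`). -/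
def stableDensity (α β t x : ℝ) : ℝ :=
  1 / (2 * π) * (∫ ω : ℝ, Complex.exp (-(Complex.I * ω * x)) * stableCharFun α β t ω).re

/-- The one-sided stable density, the case `β = -α` with `0 < α < 1`; its Laplace transform
is `s ↦ exp (-t s^α)`. -/
def oneSidedDensity (α t x : ℝ) : ℝ := stableDensity α (-α) t x

/-- The two-scale one-sided density `h_{α₁,α₂}(t,x)`, the Laplace convolution of two one-sided
stable densities. -/
def twoScaleDensity (α₁ α₂ t x : ℝ) : ℝ :=
  ∫ y in (0 : ℝ)..x, oneSidedDensity α₁ t y * oneSidedDensity α₂ t (x - y)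

/-- The parameter list `Δ(n, a) = a/n, (a+1)/n, …, (a+n-1)/n`. -/
def deltaList (n : ℕ) (a : ℝ) : List ℝ := (List.range n).map fun j => (a + j) / n

/-- The Pochhammer symbol `(a)_j = a (a+1) ⋯ (a+j-1)`. -/
def poch (a : ℝ) (j : ℕ) : ℝ := (ascPochhammer ℝ j).eval a

/-- The `j`-th term `z^j / j! · ∏ (a_i)_j / ∏ (b_i)_j` of the generalized hypergeometric series
with upper parameters `as` and lower parameters `bs`. -/
def hypTerm (as bs : List ℝ) (z : ℝ) (j : ℕ) : ℝ :=
  z ^ j / (j.factorial : ℝ) * ((as.map fun a => poch a j).prod / (bs.map fun b => poch b j).prod)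

/-- The generalized hypergeometric function `_pF_q(as; bs; z)`. -/
def hyp (as bs : List ℝ) (z : ℝ) : ℝ := ∑' j : ℕ, hypTerm as bs z j

/-- `m = min (l/k, p/q)`. -/
def mMin (l k p q : ℕ) : ℝ := min ((l : ℝ) / k) ((p : ℝ) / q)

/-- `M = max (l/k, p/q)`. -/
def mMax (l k p q : ℕ) : ℝ := max ((l : ℝ) / k) ((p : ℝ) / q)

/-- `m₁ = min (kp, lq)`. -/
def mOne (l k p q : ℕ) : ℕ := min (k * p) (l * q)

/-- `κ = (lp)^{lp} / m₁^{m₁} · (t^{1/M} / x)^{lp}`. -/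
def kappa (l k p q : ℕ) (t x : ℝ) : ℝ :=
  ((l * p : ℕ) : ℝ) ^ (l * p) / (mOne l k p q : ℝ) ^ mOne l k p q *
    (t ^ (1 / mMax l k p q) / x) ^ (l * p)

/-- The upper parameters `1, Δ(lp, 1 + Mn + mr)`. -/
def upperParams (l k p q r n : ℕ) : List ℝ :=
  1 :: deltaList (l * p) (1 + mMax l k p q * n + mMin l k p q * r)

/-- The lower parameters `Δ(m₁, 1 + n)`. -/
def lowerParams (l k p q n : ℕ) : List ℝ := deltaList (mOne l k p q) (1 + n)

/-- The argument `(-1)^{m₁ - lp} κ`. The exponent is nonnegative when `l/k` and `p/q` are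
at most `1`. -/
def hypArg (l k p q : ℕ) (t x : ℝ) : ℝ := (-1) ^ (mOne l k p q - l * p) * kappa l k p q t x

/-- The `(r, n)` term of the hypergeometric series representation of `h_{l/k,p/q}(t,x)`. -/
def seriesTerm (l k p q : ℕ) (t x : ℝ) (r n : ℕ) : ℝ :=
  -(1 / π) * ((-t) ^ (n + r) / ((n.factorial : ℝ) * (r.factorial : ℝ)) *
    (Gamma (1 + mMax l k p q * n + mMin l k p q * r) /
      x ^ (1 + mMax l k p q * n + mMin l k p q * r)) *
    sin (π * mMax l k p q * n + π * mMin l k p q * r) *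
    hyp (upperParams l k p q r n) (lowerParams l k p q n) (hypArg l k p q t x))

end

end TwoScale

namespace TwoScale

section

open Real MeasureTheory Filter Topology Set

/-! The Laplace transform of `h` is `exp (-t z^M - t z^m)`, analytic and rapidly decaying in the
right half-plane, so everything is read off from its Bromwich integral. That formula comes from the
convolution theorem applied to the densities multiplied by `e^{-x}` (`ofReal_twoScaleDensity`).

For the series, the contour is folded onto the negative real axis (`integral_logKernel_rotate`).
There the integral becomes the imaginary part of a Laplace integral of `exp (-t e^{iπM} u^M - t
e^{iπm} u^m)`. Both exponents are below 1, so expanding the exponential and integrating termwise is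
legitimate and gives an absolutely convergent double Gamma series (`hasSum_twoScaleDensity`). Since
`M m₁ = lp` is an integer, replacing `n` by `n + m₁` shifts the Gamma argument by an integer. The
multiplication formula for Pochhammer symbols then turns each residue class of `n` modulo `m₁` into
one hypergeometric series (`hypergeometric_expansion`).

For small `x`, the Bromwich line is instead moved to `re z = s`, which gives `|h| ≤ K exp (s x - t
s^M)` (`exists_abs_twoScaleDensity_le`). The best `s` produces exactly the exponent `-A κ^{1/A}`,
and `κ^{5/2} ≥ 1` near the origin absorbs the rest. -/

/-! ### Contour shifts and Bromwich integrals in the right half-plane -/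

/-- Contour shift between two horizontal lines. -/
lemma integral_horizontal_line_eq {f : ℂ → ℂ} {a b : ℝ} (hab : a ≤ b)
    (hc : ContinuousOn f {z | a ≤ z.im ∧ z.im ≤ b})
    (hd : DifferentiableOn ℂ f {z | a < z.im ∧ z.im < b})
    (ha : Integrable fun x : ℝ => f (x + a * Complex.I))
    (hb : Integrable fun x : ℝ => f (x + b * Complex.I))
    {g : ℝ → ℝ} (hg : Tendsto g atTop (𝓝 0))
    (hfg : ∀ᶠ R : ℝ in atTop, ∀ y ∈ Icc a b,
      ‖f ((R : ℂ) + y * Complex.I)‖ ≤ g R ∧ ‖f (((-R : ℝ) : ℂ) + y * Complex.I)‖ ≤ g R) :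
    ∫ x : ℝ, f (x + a * Complex.I) = ∫ x : ℝ, f (x + b * Complex.I) := by
  have h1 := intervalIntegral_tendsto_integral ha tendsto_neg_atTop_atBot tendsto_id
  have h2 := intervalIntegral_tendsto_integral hb tendsto_neg_atTop_atBot tendsto_id
  have h3 : Tendsto (fun R : ℝ => (∫ x in (-R)..R, f (x + a * Complex.I)) -
      ∫ x in (-R)..R, f (x + b * Complex.I)) atTop (𝓝 0) := by
    have hbd : Tendsto (fun R => 2 * (g R * (b - a))) atTop (𝓝 0) := by
      simpa using (hg.mul_const (b - a)).const_mul 2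
    refine squeeze_zero_norm' ?_ hbd
    filter_upwards [hfg, eventually_gt_atTop 0] with R hR hR0
    have key := Complex.integral_boundary_rect_eq_zero_of_continuousOn_of_differentiableOn f
      (⟨-R, a⟩ : ℂ) (⟨R, b⟩ : ℂ) (hc.mono ?_) (hd.mono ?_)
    · simp only at key
      have e : (∫ x in (-R)..R, f (x + a * Complex.I)) - ∫ x in (-R)..R, f (x + b * Complex.I)
          = Complex.I • (∫ y in a..b, f (((-R : ℝ) : ℂ) + y * Complex.I)) -
            Complex.I • (∫ y in a..b, f ((R : ℂ) + y * Complex.I)) := by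
        linear_combination key
      rw [e]
      have b1 := intervalIntegral.norm_integral_le_of_norm_le_const (a := a) (b := b)
        (f := fun y : ℝ => f (((-R : ℝ) : ℂ) + y * Complex.I)) (C := g R) (fun y hy => by
          rw [uIoc_of_le hab] at hy
          exact (hR y ⟨hy.1.le, hy.2⟩).2)
      have b2 := intervalIntegral.norm_integral_le_of_norm_le_const (a := a) (b := b)
        (f := fun y : ℝ => f ((R : ℂ) + y * Complex.I)) (C := g R) (fun y hy => by
          rw [uIoc_of_le hab] at hy
          exact (hR y ⟨hy.1.le, hy.2⟩).1)
      rw [abs_of_nonneg (sub_nonneg.2 hab)] at b1 b2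
      refine (norm_sub_le _ _).trans ?_
      simp only [norm_smul, Complex.norm_I, one_mul]
      linarith
    · intro z hz
      simp only [Complex.mem_reProdIm, uIcc_of_le hab] at hz
      exact hz.2
    · intro z hz
      simp only [Complex.mem_reProdIm, min_eq_left hab, max_eq_right hab] at hz
      exact hz.2
  exact sub_eq_zero.1 (tendsto_nhds_unique (h1.sub h2) h3)

/-- Here `|arg z| ≤ π/2`, so the argument of `z^a` stays within `πa/2 < π/2`. This is the source of
decay along vertical lines. -/
lemma cos_mul_abs_im_rpow_le_re_cpow {a : ℝ} (ha : 0 < a) (ha1 : a < 1) {z : ℂ} (hz : 0 ≤ z.re) :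
    cos (π / 2 * a) * |z.im| ^ a ≤ (z ^ (a : ℂ)).re := by
  rw [Complex.cpow_ofReal_re]
  have h := Complex.abs_arg_le_pi_div_two_iff.2 hz
  have hpi := pi_pos
  have h1 : cos (π / 2 * a) ≤ cos (z.arg * a) := by
    rw [← cos_abs (z.arg * a), abs_mul, abs_of_pos ha]
    refine cos_le_cos_of_nonneg_of_le_pi (by positivity) (by nlinarith) (by gcongr)
  have h0 : 0 ≤ cos (π / 2 * a) := cos_nonneg_of_mem_Icc ⟨by nlinarith, by nlinarith⟩
  rw [mul_comm]
  exact mul_le_mul (rpow_le_rpow (abs_nonneg _) (Complex.abs_im_le_norm z) ha.le) h1 h0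
    (by positivity)

lemma re_rpow_le_re_cpow {a : ℝ} (ha : 0 < a) (ha1 : a < 1) {z : ℂ} (hz : 0 ≤ z.re) :
    z.re ^ a ≤ (z ^ (a : ℂ)).re := by
  rw [Complex.cpow_ofReal_re]
  have h := Complex.abs_arg_le_pi_div_two_iff.2 hz
  have hc0 : 0 ≤ cos z.arg := cos_nonneg_of_mem_Icc (abs_le.1 h)
  have e : z.re = ‖z‖ * cos z.arg := (Complex.norm_mul_cos_arg z).symm
  rw [e, mul_rpow (norm_nonneg _) hc0]
  gcongr
  -- With `θ = arg z`, what remains is `(cos θ)^a ≤ cos (a θ)`. The number `a cos θ + (1 - a)`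
  -- separates the two sides: weighted AM-GM on the left, concavity of the cosine between `θ` and
  -- `0` on the right.
  have h1 := geom_mean_le_arith_mean2_weighted ha.le (sub_nonneg.2 ha1.le) hc0 zero_le_one
    (by ring)
  have h2 := strictConcaveOn_cos_Icc.concaveOn.2 (abs_le.1 h)
    (⟨by linarith [pi_pos], by linarith [pi_pos]⟩ : (0 : ℝ) ∈ Icc (-(π / 2)) (π / 2))
    ha.le (sub_nonneg.2 ha1.le) (by ring)
  simp only [smul_eq_mul, mul_zero, add_zero, cos_zero, one_rpow, mul_one] at h1 h2
  rw [mul_comm z.arg a]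
  linarith

/-- The Laplace transform `exp (-t₁ z^a - t₂ z^b)` of the two-scale one-sided law. -/
noncomputable def laplaceExp (a b t₁ t₂ : ℝ) (z : ℂ) : ℂ :=
  Complex.exp (-(t₁ * z ^ (a : ℂ) + t₂ * z ^ (b : ℂ)))

section HalfPlane

variable {a b t₁ t₂ : ℝ}

/-- The two powers get different tasks: `z^a` supplies integrability along the line, `z^b` supplies
decay as the line moves right. -/
lemma norm_laplaceExp_le (ha : 0 < a) (ha1 : a < 1) (hb : 0 < b) (hb1 : b < 1) (ht₁ : 0 ≤ t₁)
    (ht₂ : 0 ≤ t₂) {z : ℂ} (hz : 0 ≤ z.re) :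
    ‖laplaceExp a b t₁ t₂ z‖ ≤
      exp (-(t₁ * cos (π / 2 * a)) * |z.im| ^ a) * exp (-(t₂ * z.re ^ b)) := by
  rw [laplaceExp, Complex.norm_exp, ← Real.exp_add]
  refine exp_le_exp.2 ?_
  simp only [Complex.neg_re, Complex.add_re, Complex.re_ofReal_mul]
  have h1 := mul_le_mul_of_nonneg_left (cos_mul_abs_im_rpow_le_re_cpow ha ha1 hz) ht₁
  have h2 := mul_le_mul_of_nonneg_left (re_rpow_le_re_cpow hb hb1 hz) ht₂
  linarith

lemma continuousAt_laplaceExp (ha : 0 < a) (hb : 0 < b) {z : ℂ} (hz : 0 ≤ z.re) :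
    ContinuousAt (laplaceExp a b t₁ t₂) z := by
  unfold laplaceExp
  have h1 := Complex.continuousAt_cpow_const_of_re_pos (z := z) (w := (a : ℂ)) (Or.inl hz)
    (by simpa using ha)
  have h2 := Complex.continuousAt_cpow_const_of_re_pos (z := z) (w := (b : ℂ)) (Or.inl hz)
    (by simpa using hb)
  fun_prop

lemma differentiableAt_laplaceExp {z : ℂ} (hz : 0 < z.re) :
    DifferentiableAt ℂ (laplaceExp a b t₁ t₂) z := by
  unfold laplaceExp
  have hs : z ∈ Complex.slitPlane := Or.inl hz
  have h1 : DifferentiableAt ℂ (fun z : ℂ => z ^ (a : ℂ)) z :=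
    differentiableAt_id.cpow_const hs
  have h2 : DifferentiableAt ℂ (fun z : ℂ => z ^ (b : ℂ)) z :=
    differentiableAt_id.cpow_const hs
  fun_prop

lemma continuous_laplaceExp_line (ha : 0 < a) (hb : 0 < b) {s : ℝ} (hs : 0 ≤ s) :
    Continuous fun ω : ℝ => laplaceExp a b t₁ t₂ (s + ω * Complex.I) := by
  refine continuous_iff_continuousAt.2 fun ω => ?_
  refine ContinuousAt.comp (f := fun ω : ℝ => (s + ω * Complex.I : ℂ))
    (continuousAt_laplaceExp ha hb (by simpa using hs)) (by fun_prop)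

lemma integrable_exp_neg_mul_abs_rpow {c : ℝ} (hc : 0 < c) (ha : 0 < a) :
    Integrable fun ω : ℝ => exp (-c * |ω| ^ a) := by
  have h := integrableOn_rpow_mul_exp_neg_mul_rpow (s := 0) (by norm_num) ha hc
  have h1 : IntegrableOn (fun ω : ℝ => exp (-c * |ω| ^ a)) (Ioi 0) :=
    h.congr_fun (fun x hx => by simp [abs_of_pos (mem_Ioi.1 hx)]) measurableSet_Ioi
  have h2 : IntegrableOn (fun ω : ℝ => exp (-c * |ω| ^ a)) (Iic 0) := by
    rw [integrableOn_Iic_iff_integrableOn_Iio]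
    have := h1.comp_neg
    simpa using this
  rw [← integrableOn_univ, ← Iic_union_Ioi (a := (0 : ℝ))]
  exact h2.union h1

lemma stable_rate_pos (ha : 0 < a) (ha1 : a < 1) (ht₁ : 0 < t₁) : 0 < t₁ * cos (π / 2 * a) := by
  have hpi := pi_pos
  exact mul_pos ht₁ (cos_pos_of_mem_Ioo ⟨by nlinarith, by nlinarith⟩)

lemma integrable_laplaceExp_line (ha : 0 < a) (ha1 : a < 1) (hb : 0 < b) (hb1 : b < 1)
    (ht₁ : 0 < t₁) (ht₂ : 0 ≤ t₂) {s : ℝ} (hs : 0 ≤ s) :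
    Integrable fun ω : ℝ => laplaceExp a b t₁ t₂ (s + ω * Complex.I) := by
  refine (integrable_exp_neg_mul_abs_rpow (stable_rate_pos ha ha1 ht₁) ha).mono'
    (continuous_laplaceExp_line ha hb hs).aestronglyMeasurable (ae_of_all _ fun ω => ?_)
  refine (norm_laplaceExp_le ha ha1 hb hb1 ht₁.le ht₂ (by simpa using hs)).trans ?_
  simp only [Complex.add_im, Complex.ofReal_im, Complex.mul_im, Complex.ofReal_re,
    Complex.I_im, mul_one, Complex.I_re, mul_zero, add_zero, zero_add, Complex.add_re,
    Complex.mul_re, sub_zero]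
  refine mul_le_of_le_one_right (exp_nonneg _) (exp_le_one_iff.2 ?_)
  have := mul_nonneg ht₂ (rpow_nonneg hs b)
  simpa using this

/-- The Bromwich integral of `laplaceExp` along the line `re z = s`. -/
noncomputable def bromwich (a b t₁ t₂ s x : ℝ) : ℂ :=
  ∫ ω : ℝ, Complex.exp ((s + ω * Complex.I) * x) * laplaceExp a b t₁ t₂ (s + ω * Complex.I)

lemma norm_exp_line (s ω x : ℝ) : ‖Complex.exp ((s + ω * Complex.I) * x)‖ = exp (s * x) := by
  rw [Complex.norm_exp]
  simp

lemma integrable_bromwich (ha : 0 < a) (ha1 : a < 1) (hb : 0 < b) (hb1 : b < 1)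
    (ht₁ : 0 < t₁) (ht₂ : 0 ≤ t₂) {s : ℝ} (hs : 0 ≤ s) (x : ℝ) :
    Integrable fun ω : ℝ => Complex.exp ((s + ω * Complex.I) * x) *
      laplaceExp a b t₁ t₂ (s + ω * Complex.I) :=
  (integrable_laplaceExp_line ha ha1 hb hb1 ht₁ ht₂ hs).bdd_mul (c := exp (s * x))
    (by fun_prop) (ae_of_all _ fun ω => (norm_exp_line s ω x).le)

lemma norm_bromwich_le (ha : 0 < a) (ha1 : a < 1) (hb : 0 < b) (hb1 : b < 1)
    (ht₁ : 0 < t₁) (ht₂ : 0 ≤ t₂) {s : ℝ} (hs : 0 ≤ s) (x : ℝ) :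
    ‖bromwich a b t₁ t₂ s x‖ ≤
      exp (s * x - t₂ * s ^ b) * ∫ ω : ℝ, exp (-(t₁ * cos (π / 2 * a)) * |ω| ^ a) := by
  rw [← integral_const_mul]
  refine norm_integral_le_of_norm_le
    ((integrable_exp_neg_mul_abs_rpow (stable_rate_pos ha ha1 ht₁) ha).const_mul _)
    (ae_of_all _ fun ω => ?_)
  rw [norm_mul, norm_exp_line, sub_eq_add_neg, exp_add]
  have h := norm_laplaceExp_le (z := s + ω * Complex.I) ha ha1 hb hb1 ht₁.le ht₂
    (by simpa using hs)
  simp only [Complex.add_im, Complex.ofReal_im, Complex.mul_im, Complex.ofReal_re,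
    Complex.I_im, mul_one, Complex.I_re, mul_zero, add_zero, zero_add, Complex.add_re,
    Complex.mul_re, sub_zero] at h
  rw [mul_assoc, mul_comm (exp (-(t₂ * s ^ b)))]
  gcongr

lemma bromwich_eq_bromwich_zero (ha : 0 < a) (ha1 : a < 1) (hb : 0 < b) (hb1 : b < 1)
    (ht₁ : 0 < t₁) (ht₂ : 0 ≤ t₂) {s : ℝ} (hs : 0 ≤ s) (x : ℝ) :
    bromwich a b t₁ t₂ s x = bromwich a b t₁ t₂ 0 x := by
  -- The substitution `z = I w` sends the horizontal line `im w = -y` to the vertical line `re z =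
  -- y`.
  set f : ℂ → ℂ := fun w => Complex.exp (Complex.I * w * x) *
    laplaceExp a b t₁ t₂ (Complex.I * w) with hf
  have hline (y ω : ℝ) : f (ω + ((-y : ℝ) : ℂ) * Complex.I) =
      Complex.exp ((y + ω * Complex.I) * x) * laplaceExp a b t₁ t₂ (y + ω * Complex.I) := by
    have : Complex.I * (ω + ((-y : ℝ) : ℂ) * Complex.I) = y + ω * Complex.I := by
      push_cast
      linear_combination (-(y : ℂ)) * Complex.I_mul_I
    simp only [hf, this]
  have hre (w : ℂ) : (Complex.I * w).re = -w.im := by simp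
  have hR (y ω : ℝ) (hy : 0 ≤ y) (hys : y ≤ s) : ‖f (ω + ((-y : ℝ) : ℂ) * Complex.I)‖ ≤
      exp (s * |x|) * exp (-(t₁ * cos (π / 2 * a)) * |ω| ^ a) := by
    rw [hline, norm_mul, norm_exp_line]
    have h := norm_laplaceExp_le (z := y + ω * Complex.I) ha ha1 hb hb1 ht₁.le ht₂
      (by simpa using hy)
    simp only [Complex.add_im, Complex.ofReal_im, Complex.mul_im, Complex.ofReal_re,
      Complex.I_im, mul_one, Complex.I_re, mul_zero, add_zero, zero_add, Complex.add_re,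
      Complex.mul_re, sub_zero] at h
    have h' := h.trans (mul_le_of_le_one_right (exp_nonneg _) (exp_le_one_iff.2
      (neg_nonpos.2 (mul_nonneg ht₂ (rpow_nonneg hy b)))))
    have h2 : exp (y * x) ≤ exp (s * |x|) := by
      refine exp_le_exp.2 ((mul_le_mul_of_nonneg_left (le_abs_self x) hy).trans ?_)
      gcongr
    gcongr
  -- The upper height is written `-0` so that `hline` applies to it with `y = 0`.
  have key := integral_horizontal_line_eq (f := f) (a := -s) (b := ((-0 : ℝ))) (by simpa using hs)
    ?_ ?_ ?_ ?_ (g := fun R => exp (s * |x|) * exp (-(t₁ * cos (π / 2 * a)) * |R| ^ a)) ?_ ?_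
  · simp only [hline] at key
    exact key
  · intro w hw
    refine ContinuousAt.continuousWithinAt ?_
    have h1 : ContinuousAt (fun w => laplaceExp a b t₁ t₂ (Complex.I * w)) w :=
      ContinuousAt.comp (f := fun w => Complex.I * w)
        (continuousAt_laplaceExp ha hb (by rw [hre]; simpa using hw.2)) (by fun_prop)
    fun_prop
  · intro w hw
    refine DifferentiableAt.differentiableWithinAt ?_
    have h1 : DifferentiableAt ℂ (fun w => laplaceExp a b t₁ t₂ (Complex.I * w)) w :=
      DifferentiableAt.comp (f := fun w => Complex.I * w) w
        (differentiableAt_laplaceExp (by rw [hre]; simpa using hw.2)) (by fun_prop)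
    fun_prop
  · simp only [hline]
    exact integrable_bromwich ha ha1 hb hb1 ht₁ ht₂ hs x
  · simp only [hline]
    exact integrable_bromwich ha ha1 hb hb1 ht₁ ht₂ le_rfl x
  · have h1 : Tendsto (fun R : ℝ => (t₁ * cos (π / 2 * a)) * |R| ^ a) atTop atTop :=
      ((tendsto_rpow_atTop ha).comp tendsto_abs_atTop_atTop).const_mul_atTop
        (stable_rate_pos ha ha1 ht₁)
    have h2 := (tendsto_exp_neg_atTop_nhds_zero.comp h1).const_mul (exp (s * |x|))
    simpa [Function.comp_def] using h2
  · refine Eventually.of_forall fun R y hy => ?_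
    have hy' := hR (-y)
    simp only [neg_neg] at hy'
    refine ⟨hy' R (by simpa using hy.2) (by linarith [hy.1]), ?_⟩
    simpa using hy' (-R) (by simpa using hy.2) (by linarith [hy.1])

end HalfPlane

/-! ### Stable densities as Bromwich integrals -/

open scoped FourierTransform Convolution

lemma mul_I_cpow_eq {a : ℝ} (ha : 0 < a) (ω : ℝ) :
    (ω * Complex.I : ℂ) ^ (a : ℂ) =
      ((|ω| ^ a : ℝ) : ℂ) * Complex.exp (Complex.I * ((π / 2 * a * SignType.sign ω : ℝ) : ℂ)) := by
  rcases eq_or_ne ω 0 with rfl | h0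
  · simp [ha.ne', Real.zero_rpow ha.ne']
  · have hne : (ω * Complex.I : ℂ) ≠ 0 := by simp [h0]
    have harg : (ω * Complex.I : ℂ).arg = π / 2 * SignType.sign ω := by
      rcases lt_or_gt_of_ne h0 with h | h
      · have : (ω * Complex.I : ℂ) = ((-ω : ℝ) : ℂ) * -Complex.I := by push_cast; ring
        rw [this, Complex.arg_real_mul _ (neg_pos.2 h), Complex.arg_neg_I, sign_neg h]
        simp
      · rw [Complex.arg_real_mul _ h, Complex.arg_I, sign_pos h]
        simp
    rw [Complex.cpow_def_of_ne_zero hne, Complex.log, harg, Real.rpow_def_of_pos (abs_pos.2 h0),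
      Complex.ofReal_exp, ← Complex.exp_add]
    congr 1
    simp only [norm_mul, Complex.norm_real, Complex.norm_I, mul_one, Real.norm_eq_abs]
    push_cast
    ring

lemma stableCharFun_neg_eq_laplaceExp {a : ℝ} (ha : 0 < a) (b t ω : ℝ) :
    stableCharFun a (-a) t (-ω) = laplaceExp a b t 0 ((0 : ℝ) + ω * Complex.I) := by
  rw [stableCharFun, laplaceExp, Complex.ofReal_zero, zero_add, mul_I_cpow_eq ha, abs_neg,
    Left.sign_neg]
  congr 1
  push_cast
  ring_nf

lemma star_stableCharFun (a b t ω : ℝ) :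
    (starRingEnd ℂ) (stableCharFun a b t ω) = stableCharFun a b t (-ω) := by
  rw [stableCharFun, stableCharFun, ← Complex.exp_conj]
  simp only [map_mul, map_neg, Complex.conj_ofReal, ← Complex.exp_conj, Complex.conj_I, abs_neg,
    Left.sign_neg]
  congr 3
  push_cast
  ring

/-- The integrand at `-ω` is the conjugate of that at `ω`, so taking the real part loses nothing.
The reflection `ω ↦ -ω` then matches the kernel with `e^{zx}`, `z = iω`. The exponent `b` is
arbitrary because its coefficient is zero. -/
lemma ofReal_oneSidedDensity {a : ℝ} (ha : 0 < a) (b t x : ℝ) :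
    (oneSidedDensity a t x : ℂ) = 1 / (2 * π) * bromwich a b t 0 0 x := by
  set F : ℝ → ℂ := fun ω => Complex.exp (-(Complex.I * ω * x)) * stableCharFun a (-a) t ω with hF
  have hstar (ω : ℝ) : (starRingEnd ℂ) (F ω) = F (-ω) := by
    simp only [hF, map_mul, ← Complex.exp_conj, star_stableCharFun, map_neg, Complex.conj_ofReal,
      Complex.conj_I]
    push_cast
    ring_nf
  have hreal : (((∫ ω, F ω).re : ℝ) : ℂ) = ∫ ω, F ω := by
    rw [← Complex.conj_eq_iff_re, ← integral_conj]
    simp only [hstar]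
    exact integral_neg_eq_self F volume
  have hbr : bromwich a b t 0 0 x = ∫ ω, F ω := by
    rw [← integral_neg_eq_self F volume]
    refine integral_congr_ae (ae_of_all _ fun ω => ?_)
    simp only [hF, stableCharFun_neg_eq_laplaceExp ha b]
    push_cast
    ring_nf
  rw [oneSidedDensity, stableDensity, hbr, ← hreal]
  push_cast
  rfl

/-- The value does not depend on the line, and the factor `e^{sx}` tends to zero as `s → ∞` when `x
< 0`. -/
lemma bromwich_eq_zero_of_neg {a b t : ℝ} (ha : 0 < a) (ha1 : a < 1) (hb : 0 < b) (hb1 : b < 1)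
    (ht : 0 < t) {x : ℝ} (hx : x < 0) : bromwich a b t 0 0 x = 0 := by
  have hbd : Tendsto (fun s : ℝ => exp (s * x) *
      ∫ ω : ℝ, exp (-(t * cos (π / 2 * a)) * |ω| ^ a)) atTop (𝓝 0) := by
    have h1 : Tendsto (fun s : ℝ => s * x) atTop atBot := tendsto_id.atTop_mul_const_of_neg hx
    simpa using (tendsto_exp_atBot.comp h1).mul_const
      (∫ ω : ℝ, exp (-(t * cos (π / 2 * a)) * |ω| ^ a))
  have hle : ‖bromwich a b t 0 0 x‖ ≤ 0 := by
    refine ge_of_tendsto hbd ?_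
    filter_upwards [eventually_ge_atTop 0] with s hs
    rw [← bromwich_eq_bromwich_zero ha ha1 hb hb1 ht le_rfl hs]
    simpa using norm_bromwich_le ha ha1 hb hb1 ht le_rfl hs x
  exact norm_le_zero_iff.1 hle

lemma oneSidedDensity_of_neg {a t : ℝ} (ha : 0 < a) (ha1 : a < 1) (ht : 0 < t) {x : ℝ}
    (hx : x < 0) : oneSidedDensity a t x = 0 := by
  have h := ofReal_oneSidedDensity ha a t x
  rw [bromwich_eq_zero_of_neg ha ha1 ha ha1 ht hx, mul_zero] at h
  exact_mod_cast h

/-! ### Fourier inversion and the convolution theorem -/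

/-- The restriction of `laplaceExp` to the line `re z = 1`, in the frequency variable. -/
noncomputable def laplaceLine (a b t₁ t₂ ξ : ℝ) : ℂ :=
  laplaceExp a b t₁ t₂ ((1 : ℝ) + ((2 * π * ξ : ℝ) : ℂ) * Complex.I)

section Line

variable {a b t₁ t₂ : ℝ}

lemma continuous_laplaceLine (ha : 0 < a) (hb : 0 < b) : Continuous (laplaceLine a b t₁ t₂) :=
  (continuous_laplaceExp_line (s := 1) ha hb zero_le_one).comp
    (f := fun ξ : ℝ => 2 * π * ξ) (by fun_prop)

lemma integrable_laplaceLine (ha : 0 < a) (ha1 : a < 1) (hb : 0 < b) (hb1 : b < 1)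
    (ht₁ : 0 < t₁) (ht₂ : 0 ≤ t₂) : Integrable (laplaceLine a b t₁ t₂) :=
  (integrable_laplaceExp_line (s := 1) ha ha1 hb hb1 ht₁ ht₂ zero_le_one).comp_mul_left'
    (by positivity : 2 * π ≠ 0)

lemma fourierInv_laplaceLine (ha : 0 < a) (ha1 : a < 1) (hb : 0 < b) (hb1 : b < 1)
    (ht₁ : 0 < t₁) (ht₂ : 0 ≤ t₂) (x : ℝ) :
    𝓕⁻ (laplaceLine a b t₁ t₂) x =
      ((exp (-x) : ℝ) : ℂ) * (1 / (2 * π) * bromwich a b t₁ t₂ 0 x) := by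
  rw [← bromwich_eq_bromwich_zero ha ha1 hb hb1 ht₁ ht₂ zero_le_one, Real.fourierInv_eq', bromwich]
  have h := Measure.integral_comp_mul_left (fun ω : ℝ => Complex.exp (((ω * x : ℝ) : ℂ) * Complex.I)
    * laplaceExp a b t₁ t₂ ((1 : ℝ) + ω * Complex.I)) (2 * π)
  have e1 : (∫ v : ℝ, Complex.exp (((2 * π * inner ℝ v x : ℝ) : ℂ) * Complex.I) •
      laplaceLine a b t₁ t₂ v) = ∫ ξ : ℝ, Complex.exp (((2 * π * ξ * x : ℝ) : ℂ) * Complex.I)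
    * laplaceExp a b t₁ t₂ ((1 : ℝ) + ((2 * π * ξ : ℝ) : ℂ) * Complex.I) := by
    refine integral_congr_ae (ae_of_all _ fun ξ => ?_)
    simp only [laplaceLine, smul_eq_mul, RCLike.inner_apply, conj_trivial]
    congr 4
    ring
  have e2 : (∫ ω : ℝ, Complex.exp (((ω * x : ℝ) : ℂ) * Complex.I) *
      laplaceExp a b t₁ t₂ ((1 : ℝ) + ω * Complex.I)) = ((exp (-x) : ℝ) : ℂ) *
      ∫ ω : ℝ, Complex.exp (((1 : ℝ) + ω * Complex.I) * x) *
        laplaceExp a b t₁ t₂ ((1 : ℝ) + ω * Complex.I) := by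
    rw [← integral_const_mul]
    refine integral_congr_ae (ae_of_all _ fun ω => ?_)
    simp only
    rw [← mul_assoc, Complex.ofReal_exp, ← Complex.exp_add]
    congr 2
    push_cast
    ring
  rw [e1, h, abs_of_pos (by positivity), Complex.real_smul, e2]
  push_cast
  ring

lemma continuous_fourierInv_of_integrable {g : ℝ → ℂ} (hg : Integrable g) :
    Continuous (𝓕⁻ g) := by
  rw [Real.fourierInv_eq_fourier_comp_neg]
  exact VectorFourier.fourierIntegral_continuous (L := innerₗ ℝ) Real.continuous_fourierChar
    (by exact continuous_inner) hg.comp_neg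

lemma norm_fourierInv_le (g : ℝ → ℂ) (x : ℝ) : ‖𝓕⁻ g x‖ ≤ ∫ ξ, ‖g ξ‖ := by
  rw [Real.fourierInv_eq']
  refine (norm_integral_le_integral_norm _).trans_eq ?_
  simp only [norm_smul, Complex.norm_exp_ofReal_mul_I, one_mul]

lemma fourierInv_laplaceLine_eq_oneSidedDensity (ha : 0 < a) (ha1 : a < 1) (ht₁ : 0 < t₁)
    (x : ℝ) :
    𝓕⁻ (laplaceLine a a t₁ 0) x = ((exp (-x) * oneSidedDensity a t₁ x : ℝ) : ℂ) := by
  rw [fourierInv_laplaceLine ha ha1 ha ha1 ht₁ le_rfl, ← ofReal_oneSidedDensity ha]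
  push_cast
  rfl

/-- This is why the line `re z = 1` is used: the density vanishes on the negative axis and is
bounded, so the factor `e^{-x}` makes it integrable without any study of its tail. -/
lemma integrable_fourierInv_laplaceLine (ha : 0 < a) (ha1 : a < 1) (ht₁ : 0 < t₁) :
    Integrable (𝓕⁻ (laplaceLine a a t₁ 0)) := by
  have hint : IntegrableOn (fun x : ℝ => exp (-x) *
      (1 / (2 * π) * ∫ ω : ℝ, exp (-(t₁ * cos (π / 2 * a)) * |ω| ^ a))) (Ici 0) := by
    have h0 : IntegrableOn (fun x : ℝ => exp (-x)) (Ici 0) :=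
      (integrableOn_Ici_iff_integrableOn_Ioi (by finiteness)).2 (integrableOn_exp_neg_Ioi 0)
    exact Integrable.mul_const h0 _
  refine ((integrable_indicator_iff measurableSet_Ici).2 hint).mono'
    (continuous_fourierInv_of_integrable
      (integrable_laplaceLine ha ha1 ha ha1 ht₁ le_rfl)).aestronglyMeasurable
    (ae_of_all _ fun x => ?_)
  rcases lt_or_ge x 0 with hx | hx
  · rw [fourierInv_laplaceLine ha ha1 ha ha1 ht₁ le_rfl,
      bromwich_eq_zero_of_neg ha ha1 ha ha1 ht₁ hx, indicator_of_notMem (by simpa using hx)]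
    simp
  · rw [indicator_of_mem (by simpa using hx), fourierInv_laplaceLine ha ha1 ha ha1 ht₁ le_rfl,
      norm_mul, norm_mul, Complex.norm_real, Real.norm_of_nonneg (exp_nonneg _)]
    have h1 : ‖(1 / (2 * π) : ℂ)‖ = 1 / (2 * π) := by
      have : (1 / (2 * π) : ℂ) = ((1 / (2 * π) : ℝ) : ℂ) := by push_cast; rfl
      rw [this, Complex.norm_real, Real.norm_of_nonneg (by positivity)]
    rw [h1]
    have h2 := norm_bromwich_le ha ha1 ha ha1 ht₁ (le_refl 0) (le_refl 0) x
    simp only [zero_mul, sub_zero, exp_zero, one_mul] at h2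
    gcongr

lemma fourier_fourierInv_laplaceLine (ha : 0 < a) (ha1 : a < 1) (ht₁ : 0 < t₁) :
    𝓕 (𝓕⁻ (laplaceLine a a t₁ 0)) = laplaceLine a a t₁ 0 := by
  refine (continuous_laplaceLine ha ha).fourier_fourierInv_eq
    (integrable_laplaceLine ha ha1 ha ha1 ht₁ le_rfl) ?_
  have h := (integrable_fourierInv_laplaceLine ha ha1 ht₁).comp_neg
  simpa only [Real.fourierInv_eq_fourier_neg, neg_neg] using h

lemma laplaceLine_mul (ξ : ℝ) :
    laplaceLine a a t₁ 0 ξ * laplaceLine b b t₂ 0 ξ = laplaceLine a b t₁ t₂ ξ := by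
  simp only [laplaceLine, laplaceExp, ← Complex.exp_add]
  congr 1
  push_cast
  ring

/-- The Bromwich formula for the two-scale density. -/
lemma ofReal_twoScaleDensity (ha : 0 < a) (ha1 : a < 1) (hb : 0 < b) (hb1 : b < 1)
    {t : ℝ} (ht : 0 < t) {x : ℝ} (hx : 0 < x) :
    (twoScaleDensity a b t x : ℂ) = 1 / (2 * π) * bromwich a b t t 0 x := by
  set f := 𝓕⁻ (laplaceLine a a t 0) with hf
  set g := 𝓕⁻ (laplaceLine b b t 0) with hg
  have hfi : Integrable f := integrable_fourierInv_laplaceLine ha ha1 ht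
  have hgi : Integrable g := integrable_fourierInv_laplaceLine hb hb1 ht
  have hgc : Continuous g :=
    continuous_fourierInv_of_integrable (integrable_laplaceLine hb hb1 hb hb1 ht le_rfl)
  have hgb : BddAbove (range fun x => ‖g x‖) := by
    refine ⟨∫ ξ, ‖laplaceLine b b t 0 ξ‖, ?_⟩
    rintro _ ⟨x, rfl⟩
    exact norm_fourierInv_le _ x
  set L := ContinuousLinearMap.mul ℂ ℂ
  have hci : Integrable (f ⋆[L] g) := hfi.integrable_convolution L hgi
  have hcc : Continuous (f ⋆[L] g) := hgb.continuous_convolution_right_of_integrable L hfi hgc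
  have hF : 𝓕 (f ⋆[L] g) = laplaceLine a b t t := by
    ext ξ
    rw [Real.fourier_mul_convolution_eq hfi hgi, fourier_fourierInv_laplaceLine ha ha1 ht,
      fourier_fourierInv_laplaceLine hb hb1 ht, laplaceLine_mul]
  have hinv := hcc.fourierInv_fourier_eq hci
    (by rw [hF]; exact integrable_laplaceLine ha ha1 hb hb1 ht ht.le)
  rw [hF] at hinv
  have h1 := congrFun hinv x
  rw [fourierInv_laplaceLine ha ha1 hb hb1 ht ht.le, convolution_def] at h1
  -- The tilt is multiplicative, `e^{-x} = e^{-y} e^{-(x-y)}`, hence passes through the convolution.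
  -- One-sidedness of both densities cuts the integral down to `[0, x]`.
  have h2 : ∫ y, L (f y) (g (x - y)) = ((exp (-x) * twoScaleDensity a b t x : ℝ) : ℂ) := by
    have e (y : ℝ) : L (f y) (g (x - y)) =
        ((exp (-x) * (oneSidedDensity a t y * oneSidedDensity b t (x - y)) : ℝ) : ℂ) := by
      rw [ContinuousLinearMap.mul_apply', hf, hg,
        fourierInv_laplaceLine_eq_oneSidedDensity ha ha1 ht,
        fourierInv_laplaceLine_eq_oneSidedDensity hb hb1 ht, ← Complex.ofReal_mul]
      congr 1
      have : exp (-x) = exp (-y) * exp (-(x - y)) := by rw [← exp_add]; ring_nf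
      rw [this]
      ring
    simp only [e]
    rw [integral_complex_ofReal, integral_const_mul, twoScaleDensity,
      intervalIntegral.integral_of_le hx.le, ← integral_Icc_eq_integral_Ioc,
      setIntegral_eq_integral_of_forall_compl_eq_zero]
    intro y hy
    rw [mem_Icc, not_and_or, not_le, not_le] at hy
    rcases hy with hy | hy
    · rw [oneSidedDensity_of_neg ha ha1 ht hy, zero_mul]
    · rw [oneSidedDensity_of_neg hb hb1 ht (sub_neg.2 hy), mul_zero]
  rw [h2, Complex.ofReal_mul] at h1
  exact (mul_left_cancel₀ (by simp) h1).symm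

end Line

/-! ### Laplace integrals and termwise integration -/

lemma integral_exp_mul_comp_exp (g : ℝ → ℂ) :
    ∫ ρ : ℝ, ((exp ρ : ℝ) : ℂ) * g (exp ρ) = ∫ u in Ioi (0 : ℝ), g u := by
  have h := integral_image_eq_integral_abs_deriv_smul MeasurableSet.univ
    (fun x _ => (hasDerivAt_exp x).hasDerivWithinAt) exp_injective.injOn g
  rw [image_univ, range_exp, Measure.restrict_univ] at h
  simp only [h, abs_exp, Complex.real_smul]

lemma integrable_exp_mul_comp_exp {g : ℝ → ℂ} (hg : IntegrableOn g (Ioi 0)) :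
    Integrable fun ρ : ℝ => ((exp ρ : ℝ) : ℂ) * g (exp ρ) := by
  have h := integrableOn_image_iff_integrableOn_abs_deriv_smul MeasurableSet.univ
    (fun x _ => (hasDerivAt_exp x).hasDerivWithinAt) exp_injective.injOn g
  rw [image_univ, range_exp, integrableOn_univ] at h
  simpa only [abs_exp, Complex.real_smul] using h.1 hg

/-- A power below 1 is sublinear: past a threshold `N` with `t N^{a-1} ≤ ε` the linear term wins,
and before it the value at `N` is a bound. -/
lemma exists_mul_rpow_le {a t ε : ℝ} (ha : 0 < a) (ha1 : a < 1) (ht : 0 ≤ t) (hε : 0 < ε) :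
    ∃ C, ∀ u, 0 ≤ u → t * u ^ a ≤ ε * u + C := by
  have h1 : Tendsto (fun N : ℝ => t * N ^ (-(1 - a))) atTop (𝓝 0) := by
    simpa using (tendsto_rpow_neg_atTop (sub_pos.2 ha1)).const_mul t
  obtain ⟨N, hN, hN0⟩ := ((h1.eventually_le_const hε).and (eventually_gt_atTop 0)).exists
  refine ⟨t * N ^ a, fun u hu => ?_⟩
  rcases le_total u N with h | h
  · have : t * u ^ a ≤ t * N ^ a := by gcongr
    nlinarith
  · have hu0 : 0 < u := hN0.trans_le h
    have e : u ^ a = u ^ (-(1 - a)) * u := by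
      rw [← rpow_add_one hu0.ne']
      ring_nf
    have h2 : u ^ (-(1 - a)) ≤ N ^ (-(1 - a)) := rpow_le_rpow_of_nonpos hN0 h (by linarith)
    have h3 : t * u ^ a ≤ ε * u := by
      rw [e, ← mul_assoc]
      exact mul_le_mul_of_nonneg_right ((mul_le_mul_of_nonneg_left h2 ht).trans hN) hu
    have : 0 ≤ t * N ^ a := by positivity
    linarith

section TwoTerms

variable {a b : ℝ}

lemma exists_mul_rpow_add_le {s t ε : ℝ} (ha : 0 < a) (ha1 : a < 1) (hb : 0 < b) (hb1 : b < 1)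
    (hs : 0 ≤ s) (ht : 0 ≤ t) (hε : 0 < ε) :
    ∃ C, ∀ u, 0 ≤ u → s * u ^ a + t * u ^ b ≤ ε * u + C := by
  obtain ⟨C, hC⟩ := exists_mul_rpow_le ha ha1 hs (half_pos hε)
  obtain ⟨D, hD⟩ := exists_mul_rpow_le hb hb1 ht (half_pos hε)
  exact ⟨C + D, fun u hu => by linarith [hC u hu, hD u hu]⟩

lemma integrableOn_exp_mul_exp_rpow {s t x : ℝ} (ha : 0 < a) (ha1 : a < 1) (hb : 0 < b)
    (hb1 : b < 1) (hs : 0 ≤ s) (ht : 0 ≤ t) (hx : 0 < x) :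
    IntegrableOn (fun u => exp (-(x * u)) * exp (s * u ^ a + t * u ^ b)) (Ioi 0) := by
  obtain ⟨C, hC⟩ := exists_mul_rpow_add_le ha ha1 hb hb1 hs ht (half_pos hx)
  have hc : Continuous fun u : ℝ => exp (-(x * u)) * exp (s * u ^ a + t * u ^ b) := by
    have h1 := continuous_rpow_const ha.le
    have h2 := continuous_rpow_const hb.le
    fun_prop
  refine Integrable.mono' ((integrableOn_exp_mul_Ioi (a := -(x / 2)) (by linarith) 0).const_mul
    (exp C)) hc.aestronglyMeasurable
    ((ae_restrict_iff' measurableSet_Ioi).2 (ae_of_all _ fun u hu => ?_))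
  rw [Real.norm_of_nonneg (by positivity), ← exp_add, ← exp_add]
  exact exp_le_exp.2 (by linarith [hC u (le_of_lt hu)])

/-- Termwise Laplace transform of `exp (α u^a + β u^b)`. -/
lemma hasSum_laplace_exp_rpow (ha : 0 < a) (ha1 : a < 1) (hb : 0 < b) (hb1 : b < 1) {x : ℝ}
    (hx : 0 < x) (α β : ℂ) :
    HasSum (fun i : ℕ × ℕ => α ^ i.1 * β ^ i.2 / (i.1.factorial * i.2.factorial) *
        ((Gamma (1 + a * i.1 + b * i.2) / x ^ (1 + a * i.1 + b * i.2) : ℝ) : ℂ))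
      (∫ u in Ioi (0 : ℝ), ((exp (-(x * u)) : ℝ) : ℂ) *
        Complex.exp (α * ((u ^ a : ℝ) : ℂ) + β * ((u ^ b : ℝ) : ℂ))) := by
  set F : ℕ × ℕ → ℝ → ℂ := fun i u => ((exp (-(x * u)) : ℝ) : ℂ) *
    ((α * ((u ^ a : ℝ) : ℂ)) ^ i.1 / i.1.factorial *
      ((β * ((u ^ b : ℝ) : ℂ)) ^ i.2 / i.2.factorial)) with hF
  -- The termwise norms, which sum to `e^{-xu} exp (‖α‖ u^a + ‖β‖ u^b)`. Sublinearity makes this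
  -- integrable, so it dominates.
  set G : ℕ × ℕ → ℝ → ℝ := fun i u => exp (-(x * u)) *
    ((‖α‖ * u ^ a) ^ i.1 / i.1.factorial * ((‖β‖ * u ^ b) ^ i.2 / i.2.factorial)) with hG
  have hra := continuous_rpow_const ha.le
  have hrb := continuous_rpow_const hb.le
  have hGsum (u : ℝ) (hu : 0 < u) :
      HasSum (fun i => G i u) (exp (-(x * u)) * exp (‖α‖ * u ^ a + ‖β‖ * u ^ b)) := by
    rw [exp_add]
    have h1 : HasSum (fun n : ℕ => (‖α‖ * u ^ a) ^ n / n.factorial) (exp (‖α‖ * u ^ a)) := by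
      rw [Real.exp_eq_exp_ℝ]; exact NormedSpace.expSeries_div_hasSum_exp _
    have h2 : HasSum (fun n : ℕ => (‖β‖ * u ^ b) ^ n / n.factorial) (exp (‖β‖ * u ^ b)) := by
      rw [Real.exp_eq_exp_ℝ]; exact NormedSpace.expSeries_div_hasSum_exp _
    exact (h1.mul h2 (h1.summable.mul_of_nonneg h2.summable (fun n => by positivity)
      (fun n => by positivity))).mul_left _
  have hnorm (u : ℝ) (hu : 0 < u) (i : ℕ × ℕ) : ‖F i u‖ = G i u := by
    simp only [hF, hG, norm_mul, norm_div, norm_pow, Complex.norm_real, Complex.norm_natCast,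
      Real.norm_of_nonneg (exp_nonneg _), Real.norm_of_nonneg (rpow_nonneg hu.le _)]
  have hFsum (u : ℝ) (hu : 0 < u) : HasSum (fun i => F i u) (((exp (-(x * u)) : ℝ) : ℂ) *
        Complex.exp (α * ((u ^ a : ℝ) : ℂ) + β * ((u ^ b : ℝ) : ℂ))) := by
    have h1 : HasSum (fun n : ℕ => (α * ((u ^ a : ℝ) : ℂ)) ^ n / n.factorial)
        (Complex.exp (α * ((u ^ a : ℝ) : ℂ))) := by
      rw [Complex.exp_eq_exp_ℂ]; exact NormedSpace.expSeries_div_hasSum_exp _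
    have h2 : HasSum (fun n : ℕ => (β * ((u ^ b : ℝ) : ℂ)) ^ n / n.factorial)
        (Complex.exp (β * ((u ^ b : ℝ) : ℂ))) := by
      rw [Complex.exp_eq_exp_ℂ]; exact NormedSpace.expSeries_div_hasSum_exp _
    rw [Complex.exp_add]
    refine (h1.mul h2 ?_).mul_left _
    have h3 := (hGsum u hu).summable.mul_left (exp (x * u))
    refine .of_norm (h3.congr fun i => ?_)
    rw [← hnorm u hu]
    simp only [hF, norm_mul, Complex.norm_real, Real.norm_of_nonneg (exp_nonneg _)]
    rw [← mul_assoc, ← exp_add]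
    simp
  have key := hasSum_integral_of_dominated_convergence (μ := volume.restrict (Ioi (0 : ℝ)))
    (F := F) G (fun i => Continuous.aestronglyMeasurable (by fun_prop))
    ((fun i => (ae_restrict_iff' measurableSet_Ioi).2
      (ae_of_all _ fun u hu => (hnorm u hu i).le)))
    ((ae_restrict_iff' measurableSet_Ioi).2 (ae_of_all _ fun u hu => (hGsum u hu).summable))
    ((integrableOn_exp_mul_exp_rpow ha ha1 hb hb1 (norm_nonneg α) (norm_nonneg β) hx).congr_fun
      (fun u hu => (hGsum u hu).tsum_eq.symm) measurableSet_Ioi)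
    ((ae_restrict_iff' measurableSet_Ioi).2 (ae_of_all _ fun u hu => hFsum u hu))
  refine Eq.mpr (congrArg (fun f : ℕ × ℕ → ℂ => HasSum f _) (funext fun i => ?_)) key
  obtain ⟨n, r⟩ := i
  have hpos : 0 < 1 + a * n + b * r := by positivity
  have hgam := integral_rpow_mul_exp_neg_mul_Ioi hpos hx
  have e1 : ∫ u in Ioi (0 : ℝ), F (n, r) u = ∫ u in Ioi (0 : ℝ),
      α ^ n * β ^ r / (n.factorial * r.factorial) *
        ((u ^ (1 + a * n + b * r - 1) * exp (-(x * u)) : ℝ) : ℂ) := by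
    refine setIntegral_congr_fun measurableSet_Ioi fun u hu => ?_
    have hu : 0 < u := hu
    have e2 : u ^ (1 + a * n + b * r - 1) = (u ^ a) ^ n * (u ^ b) ^ r := by
      rw [← rpow_natCast (u ^ a), ← rpow_natCast (u ^ b), ← rpow_mul hu.le, ← rpow_mul hu.le,
        ← rpow_add hu]
      ring_nf
    simp only [hF, e2]
    push_cast
    ring
  rw [e1, integral_const_mul, integral_complex_ofReal, hgam, one_div, inv_rpow hx.le]
  congr 2
  ring

/-! ### Rotation of the contour onto the negative real axis -/

/-- The integrand of the Bromwich integral in the logarithmic coordinate `z = exp w`. -/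
noncomputable def logKernel (a b t x : ℝ) (w : ℂ) : ℂ :=
  Complex.exp (w + x * Complex.exp w - t * (Complex.exp (a * w) + Complex.exp (b * w)))

lemma differentiable_logKernel (a b t x : ℝ) : Differentiable ℂ (logKernel a b t x) := by
  unfold logKernel
  fun_prop

lemma norm_logKernel (a b t x ρ θ : ℝ) :
    ‖logKernel a b t x (ρ + θ * Complex.I)‖ = exp (ρ + x * (exp ρ * cos θ) -
      t * (exp (a * ρ) * cos (a * θ) + exp (b * ρ) * cos (b * θ))) := by
  rw [logKernel, Complex.norm_exp]
  simp [Complex.exp_re]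

lemma logKernel_pi_div_two (a b t x ρ : ℝ) (ha : 0 < a) (hb : 0 < b) :
    logKernel a b t x (ρ + (π / 2 : ℝ) * Complex.I) = ((exp ρ : ℝ) : ℂ) *
      (Complex.I * (Complex.exp (((0 : ℝ) + (exp ρ : ℝ) * Complex.I) * x) *
        laplaceExp a b t t ((0 : ℝ) + (exp ρ : ℝ) * Complex.I))) := by
  have hI : Complex.exp ((π / 2 : ℝ) * Complex.I) = Complex.I := by
    push_cast; exact Complex.exp_pi_div_two_mul_I
  have hc {c : ℝ} (hc : 0 < c) : (((exp ρ : ℝ) : ℂ) * Complex.I) ^ (c : ℂ) =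
      Complex.exp (c * (ρ + (π / 2 : ℝ) * Complex.I)) := by
    rw [mul_I_cpow_eq hc, abs_of_pos (exp_pos ρ), sign_pos (exp_pos ρ), ← exp_mul,
      Complex.ofReal_exp, ← Complex.exp_add]
    congr 1
    push_cast
    simp
    ring
  have hz : Complex.exp (ρ + (π / 2 : ℝ) * Complex.I) = ((exp ρ : ℝ) : ℂ) * Complex.I := by
    rw [Complex.exp_add, hI, Complex.ofReal_exp]
  rw [logKernel, laplaceExp, Complex.ofReal_zero, zero_add, hc ha, hc hb, sub_eq_add_neg,
    Complex.exp_add, Complex.exp_add, hz]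
  ring_nf

/-- At height `π` the point `z = -e^ρ` lies on the branch cut of the powers. The logarithmic
coordinate makes the kernel entire and selects the boundary value from above, `e^{iπa} u^a`. -/
lemma logKernel_pi (a b t x ρ : ℝ) :
    logKernel a b t x (ρ + π * Complex.I) = ((exp ρ : ℝ) : ℂ) *
      -(((exp (-(x * exp ρ)) : ℝ) : ℂ) * Complex.exp (
        -t * Complex.exp (π * a * Complex.I) * ((exp ρ ^ a : ℝ) : ℂ) +
        -t * Complex.exp (π * b * Complex.I) * ((exp ρ ^ b : ℝ) : ℂ))) := by
  have hz : Complex.exp (ρ + π * Complex.I) = -((exp ρ : ℝ) : ℂ) := by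
    rw [Complex.exp_add, Complex.exp_pi_mul_I, Complex.ofReal_exp]
    ring
  have hc (c : ℝ) : Complex.exp (c * (ρ + π * Complex.I)) =
      Complex.exp (π * c * Complex.I) * ((exp ρ ^ c : ℝ) : ℂ) := by
    rw [← exp_mul, Complex.ofReal_exp, ← Complex.exp_add]
    congr 1
    push_cast
    ring
  rw [logKernel, sub_eq_add_neg, Complex.exp_add, Complex.exp_add, hz, hc, hc, Complex.ofReal_exp]
  push_cast
  ring_nf

lemma tendsto_exp_sub_mul_exp {c : ℝ} (hc : 0 < c) (ha : 0 < a) :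
    Tendsto (fun R : ℝ => exp (R - c * exp (a * R))) atTop (𝓝 0) := by
  have h1 : Tendsto (fun R : ℝ => exp (a * R)) atTop atTop :=
    tendsto_exp_atTop.comp (tendsto_id.const_mul_atTop ha)
  refine ((tendsto_rpow_mul_exp_neg_mul_atTop_nhds_zero (1 / a) c hc).comp h1).congr fun R => ?_
  rw [Function.comp_apply, ← exp_mul, ← exp_add]
  congr 1
  field_simp
  ring

/-- A quarter turn in `z` is a vertical shift in `w = log z`. On the right side of the rectangle two
mechanisms of decay share the angles: the fractional powers below `θ₀`, the factor `e^{xz}` above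
it. -/
lemma integral_logKernel_rotate {t x : ℝ} (ha : 0 < a) (ha1 : a < 1) (hb : 0 < b) (hb1 : b < 1)
    (ht : 0 < t) (hx : 0 < x) :
    ∫ ρ : ℝ, logKernel a b t x (ρ + (π / 2 : ℝ) * Complex.I) =
      ∫ ρ : ℝ, logKernel a b t x (ρ + π * Complex.I) := by
  have hpi := pi_pos
  obtain ⟨c, hca, hcb, hc1⟩ : ∃ c : ℝ, a ≤ c ∧ b ≤ c ∧ c < 1 :=
    ⟨max a b, le_max_left _ _, le_max_right _ _, max_lt ha1 hb1⟩
  have hc0 : 0 < c := ha.trans_le hca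
  -- Chosen so that `θ₀ > π/2`, making `cos θ₀` negative, while `c θ₀ < π/2`, keeping both
  -- fractional powers in the right half-plane.
  set θ₀ : ℝ := π / (1 + c) with hθ₀
  have hθ0 : π / 2 < θ₀ := by rw [hθ₀]; gcongr; linarith
  have hθ1 : θ₀ < π := by rw [hθ₀, div_lt_iff₀ (by positivity)]; nlinarith
  have hcθ : c * θ₀ < π / 2 := by
    rw [hθ₀, ← mul_div_assoc, div_lt_iff₀ (by positivity)]; nlinarith
  have haθ : a * θ₀ < π / 2 := (mul_le_mul_of_nonneg_right hca (by linarith)).trans_lt hcθ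
  have hbθ : b * θ₀ < π / 2 := (mul_le_mul_of_nonneg_right hcb (by linarith)).trans_lt hcθ
  have hcos0 : cos θ₀ < 0 := cos_neg_of_pi_div_two_lt_of_lt hθ0 (by linarith)
  have hcosa : 0 < cos (a * θ₀) :=
    cos_pos_of_mem_Ioo ⟨by linarith [mul_pos ha (by linarith : 0 < θ₀)], haθ⟩
  set k : ℝ := x * -cos θ₀ with hk
  have hk0 : 0 < k := mul_pos hx (neg_pos.2 hcos0)
  obtain ⟨C, hC⟩ := exists_mul_rpow_add_le ha ha1 hb hb1 ht.le ht.le (half_pos hk0)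
  refine integral_horizontal_line_eq (f := logKernel a b t x) (by linarith)
    (differentiable_logKernel a b t x).continuous.continuousOn
    (differentiable_logKernel a b t x).differentiableOn ?_ ?_
    -- One summand per region: angles up to `θ₀`, angles beyond `θ₀`, and the left side of the
    -- rectangle, where the Jacobian `e^{-R}` alone suffices.
    (g := fun R => exp (R - t * cos (a * θ₀) * exp (a * R)) +
      exp C * exp (R - k / 2 * exp (1 * R)) + exp (2 * t) * exp (-R)) ?_ ?_
  · simp only [logKernel_pi_div_two a b t x _ ha hb]
    refine integrable_exp_mul_comp_exp (g := fun u => Complex.I *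
      (Complex.exp (((0 : ℝ) + u * Complex.I) * x) * laplaceExp a b t t ((0 : ℝ) + u * Complex.I)))
      ?_
    exact ((integrable_bromwich ha ha1 hb hb1 ht ht.le le_rfl x).const_mul _).integrableOn
  · simp only [logKernel_pi]
    refine integrable_exp_mul_comp_exp (g := fun u => -(((exp (-(x * u)) : ℝ) : ℂ) * Complex.exp (
        -t * Complex.exp (π * a * Complex.I) * ((u ^ a : ℝ) : ℂ) +
        -t * Complex.exp (π * b * Complex.I) * ((u ^ b : ℝ) : ℂ)))) ?_
    refine Integrable.mono' (integrableOn_exp_mul_exp_rpow ha ha1 hb hb1 ht.le ht.le hx)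
      (Continuous.aestronglyMeasurable ?_)
      ((ae_restrict_iff' measurableSet_Ioi).2 (ae_of_all _ fun u hu => ?_))
    · have h1 := continuous_rpow_const ha.le
      have h2 := continuous_rpow_const hb.le
      fun_prop
    · rw [norm_neg, norm_mul, Complex.norm_real, Real.norm_of_nonneg (exp_nonneg _)]
      gcongr
      refine (Complex.norm_exp_le_exp_norm _).trans (exp_le_exp.2 ((norm_add_le _ _).trans ?_))
      have hn (c : ℝ) : ‖Complex.exp (π * c * Complex.I)‖ = 1 := by
        rw [← Complex.ofReal_mul, Complex.norm_exp_ofReal_mul_I]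
      simp only [norm_mul, norm_neg, Complex.norm_real, hn, mul_one, Real.norm_of_nonneg ht.le,
        Real.norm_of_nonneg (rpow_nonneg (le_of_lt hu) _), le_refl]
  · have h1 := tendsto_exp_sub_mul_exp (mul_pos ht hcosa) ha
    have h2 := (tendsto_exp_sub_mul_exp (half_pos hk0) one_pos).const_mul (exp C)
    have h3 := tendsto_exp_neg_atTop_nhds_zero.const_mul (exp (2 * t))
    simpa using (h1.add h2).add h3
  · filter_upwards [eventually_ge_atTop 0] with R hR θ hθ
    have hcosθ : cos θ ≤ 0 := cos_nonpos_of_pi_div_two_le_of_le hθ.1 (by linarith [hθ.2])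
    have hθpos : 0 < θ := by linarith [hθ.1]
    rw [norm_logKernel, norm_logKernel]
    constructor
    · rcases le_total θ θ₀ with h | h
      · have h1 : cos (a * θ₀) ≤ cos (a * θ) :=
          cos_le_cos_of_nonneg_of_le_pi (by positivity) (by linarith) (by gcongr)
        have h2 : 0 ≤ cos (b * θ) := by
          have : b * θ ≤ b * θ₀ := by gcongr
          exact cos_nonneg_of_mem_Icc ⟨by linarith [mul_pos hb hθpos], by linarith⟩
        have h3 : exp (R + x * (exp R * cos θ) -
            t * (exp (a * R) * cos (a * θ) + exp (b * R) * cos (b * θ))) ≤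
            exp (R - t * cos (a * θ₀) * exp (a * R)) := by
          refine exp_le_exp.2 ?_
          have e1 : x * (exp R * cos θ) ≤ 0 :=
            mul_nonpos_of_nonneg_of_nonpos hx.le
              (mul_nonpos_of_nonneg_of_nonpos (exp_nonneg _) hcosθ)
          have e2 : 0 ≤ t * (exp (b * R) * cos (b * θ)) := by positivity
          have e3 : t * (exp (a * R) * cos (a * θ₀)) ≤ t * (exp (a * R) * cos (a * θ)) := by
            gcongr
          linarith
        have := exp_nonneg C
        have := exp_nonneg (R - k / 2 * exp (1 * R))
        have := exp_nonneg (2 * t)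
        have := exp_nonneg (-R)
        nlinarith
      · have h1 : cos θ ≤ cos θ₀ := cos_le_cos_of_nonneg_of_le_pi (by linarith) hθ.2 h
        have h3 : exp (R + x * (exp R * cos θ) -
            t * (exp (a * R) * cos (a * θ) + exp (b * R) * cos (b * θ))) ≤
            exp C * exp (R - k / 2 * exp (1 * R)) := by
          rw [← exp_add]
          refine exp_le_exp.2 ?_
          have e1 : x * (exp R * cos θ) ≤ -(k * exp R) := by
            have : x * (exp R * cos θ) ≤ x * (exp R * cos θ₀) := by gcongr
            rw [hk]
            linarith
          have e2 : t * (exp (a * R) * -cos (a * θ)) ≤ t * exp (a * R) :=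
            mul_le_mul_of_nonneg_left (mul_le_of_le_one_right (exp_nonneg _)
              (by linarith [neg_one_le_cos (a * θ)])) ht.le
          have e3 : t * (exp (b * R) * -cos (b * θ)) ≤ t * exp (b * R) :=
            mul_le_mul_of_nonneg_left (mul_le_of_le_one_right (exp_nonneg _)
              (by linarith [neg_one_le_cos (b * θ)])) ht.le
          have e4 := hC (exp R) (exp_nonneg R)
          rw [← exp_mul, ← exp_mul, mul_comm R a, mul_comm R b] at e4
          rw [one_mul]
          linarith
        have := exp_nonneg (R - t * cos (a * θ₀) * exp (a * R))
        have := mul_nonneg (exp_nonneg (2 * t)) (exp_nonneg (-R))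
        linarith
    · have h3 : exp (-R + x * (exp (-R) * cos θ) -
            t * (exp (a * -R) * cos (a * θ) + exp (b * -R) * cos (b * θ))) ≤
            exp (2 * t) * exp (-R) := by
        rw [← exp_add]
        refine exp_le_exp.2 ?_
        have e1 : x * (exp (-R) * cos θ) ≤ 0 :=
          mul_nonpos_of_nonneg_of_nonpos hx.le
            (mul_nonpos_of_nonneg_of_nonpos (exp_nonneg _) hcosθ)
        have e (d : ℝ) (hd : 0 < d) : t * (exp (d * -R) * -cos (d * θ)) ≤ t := by
          have h1 : exp (d * -R) ≤ 1 := exp_le_one_iff.2 (by nlinarith)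
          have h2 : exp (d * -R) * -cos (d * θ) ≤ 1 :=
            (mul_le_of_le_one_right (exp_nonneg _)
              (by linarith [neg_one_le_cos (d * θ)])).trans h1
          exact mul_le_of_le_one_right ht.le h2
        linarith [e a ha, e b hb]
      have := exp_nonneg (R - t * cos (a * θ₀) * exp (a * R))
      have := mul_nonneg (exp_nonneg C) (exp_nonneg (R - k / 2 * exp (1 * R)))
      linarith

lemma star_laplaceExp_imaginary {t : ℝ} (ha : 0 < a) (hb : 0 < b) (ω : ℝ) :
    (starRingEnd ℂ) (laplaceExp a b t t ((0 : ℝ) + ω * Complex.I)) =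
      laplaceExp a b t t ((0 : ℝ) + ((-ω : ℝ) : ℂ) * Complex.I) := by
  simp only [laplaceExp, Complex.ofReal_zero, zero_add, mul_I_cpow_eq ha, mul_I_cpow_eq hb,
    ← Complex.exp_conj, map_mul, map_neg, map_add, Complex.conj_ofReal, Complex.conj_I, abs_neg,
    Left.sign_neg]
  congr 4 <;> push_cast <;> ring_nf

/-- Conjugation symmetry makes the Bromwich integral twice the real part of its upper half. The
factor `I` from `dz = I dω` turns that real part into an imaginary part, which the rotation carries
to the negative axis. -/
lemma twoScaleDensity_eq_im {t x : ℝ} (ha : 0 < a) (ha1 : a < 1) (hb : 0 < b) (hb1 : b < 1)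
    (ht : 0 < t) (hx : 0 < x) :
    twoScaleDensity a b t x = -(1 / π) *
      (∫ u in Ioi (0 : ℝ), ((exp (-(x * u)) : ℝ) : ℂ) * Complex.exp (
        -t * Complex.exp (π * a * Complex.I) * ((u ^ a : ℝ) : ℂ) +
        -t * Complex.exp (π * b * Complex.I) * ((u ^ b : ℝ) : ℂ))).im := by
  set Ψ : ℝ → ℂ := fun ω => Complex.exp (((0 : ℝ) + ω * Complex.I) * x) *
    laplaceExp a b t t ((0 : ℝ) + ω * Complex.I) with hΨ
  have hi : Integrable Ψ := integrable_bromwich ha ha1 hb hb1 ht ht.le le_rfl x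
  have hstar (ω : ℝ) : (starRingEnd ℂ) (Ψ ω) = Ψ (-ω) := by
    simp only [hΨ, map_mul, star_laplaceExp_imaginary ha hb, ← Complex.exp_conj, map_add,
      Complex.conj_ofReal, Complex.conj_I]
    push_cast
    ring_nf
  have hsplit : bromwich a b t t 0 x =
      (starRingEnd ℂ) (∫ ω in Ioi (0 : ℝ), Ψ ω) + ∫ ω in Ioi (0 : ℝ), Ψ ω := by
    have h1 : bromwich a b t t 0 x = ∫ ω, Ψ ω := rfl
    rw [h1, ← integral_conj, ← intervalIntegral.integral_Iic_add_Ioi (b := 0) hi.integrableOn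
      hi.integrableOn]
    simp only [hstar]
    rw [integral_comp_neg_Ioi, neg_zero]
  have hrot := integral_logKernel_rotate ha ha1 hb hb1 ht hx
  simp only [logKernel_pi, logKernel_pi_div_two a b t x _ ha hb] at hrot
  rw [integral_exp_mul_comp_exp (fun u => Complex.I * (Complex.exp (((0 : ℝ) + u * Complex.I) * x)
      * laplaceExp a b t t ((0 : ℝ) + u * Complex.I))),
    integral_exp_mul_comp_exp (fun u => -(((exp (-(x * u)) : ℝ) : ℂ) * Complex.exp (
        -t * Complex.exp (π * a * Complex.I) * ((u ^ a : ℝ) : ℂ) +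
        -t * Complex.exp (π * b * Complex.I) * ((u ^ b : ℝ) : ℂ)))),
    integral_const_mul, integral_neg] at hrot
  have h := congrArg Complex.re (ofReal_twoScaleDensity ha ha1 hb hb1 ht hx)
  have him := congrArg Complex.im hrot
  rw [Complex.I_mul_im, Complex.neg_im] at him
  have hpi : (1 / (2 * π) : ℂ) = ((1 / (2 * π) : ℝ) : ℂ) := by push_cast; rfl
  rw [Complex.ofReal_re, hsplit, hpi, Complex.re_ofReal_mul, Complex.add_re, Complex.conj_re, him]
    at h
  rw [h]
  field_simp
  ring

/-! ### The double Gamma series -/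

lemma hasSum_twoScaleDensity {t x : ℝ} (ha : 0 < a) (ha1 : a < 1) (hb : 0 < b) (hb1 : b < 1)
    (ht : 0 < t) (hx : 0 < x) :
    HasSum (fun i : ℕ × ℕ => -(1 / π) * ((-t) ^ (i.1 + i.2) /
        ((i.1.factorial : ℝ) * (i.2.factorial : ℝ)) *
        (Gamma (1 + a * i.1 + b * i.2) / x ^ (1 + a * i.1 + b * i.2)) *
        sin (π * a * i.1 + π * b * i.2)))
      (twoScaleDensity a b t x) := by
  have h := (Complex.hasSum_im (hasSum_laplace_exp_rpow ha ha1 hb hb1 hx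
    (-t * Complex.exp (π * a * Complex.I)) (-t * Complex.exp (π * b * Complex.I)))).mul_left
    (-(1 / π))
  rw [← twoScaleDensity_eq_im ha ha1 hb hb1 ht hx] at h
  refine Eq.mpr (congrArg (fun f : ℕ × ℕ → ℝ => HasSum f _) (funext fun i => ?_)) h
  obtain ⟨n, r⟩ := i
  congr 1
  have e : (-t * Complex.exp (π * a * Complex.I)) ^ n * (-t * Complex.exp (π * b * Complex.I)) ^ r =
      (((-t) ^ (n + r) : ℝ) : ℂ) * Complex.exp (((π * a * n + π * b * r : ℝ) : ℂ) * Complex.I) := by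
    rw [mul_pow, mul_pow, ← Complex.exp_nat_mul, ← Complex.exp_nat_mul]
    have e2 : (((π * a * n + π * b * r : ℝ) : ℂ) * Complex.I) =
        n * (π * a * Complex.I) + r * (π * b * Complex.I) := by push_cast; ring
    rw [e2, Complex.exp_add]
    push_cast
    ring
  simp only
  set A : ℝ := (-t) ^ (n + r)
  set φ : ℝ := π * a * n + π * b * r
  set Q : ℝ := Gamma (1 + a * n + b * r) / x ^ (1 + a * n + b * r)
  have e3 : (A : ℂ) * Complex.exp (φ * Complex.I) / (n.factorial * r.factorial) * (Q : ℂ) =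
      ((A / (n.factorial * r.factorial) * Q : ℝ) : ℂ) * Complex.exp (φ * Complex.I) := by
    push_cast
    ring
  rw [e, e3, Complex.im_ofReal_mul, Complex.exp_ofReal_mul_I_im]

/-- The termwise Laplace transform with both coefficients equal to `t`, without phases; for `t > 0`
it majorizes the density series. -/
lemma summable_gamma_double {t x : ℝ} (ha : 0 < a) (ha1 : a < 1) (hb : 0 < b) (hb1 : b < 1)
    (hx : 0 < x) :
    Summable fun i : ℕ × ℕ => t ^ (i.1 + i.2) /
        ((i.1.factorial : ℝ) * (i.2.factorial : ℝ)) *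
        (Gamma (1 + a * i.1 + b * i.2) / x ^ (1 + a * i.1 + b * i.2)) := by
  have h := Complex.hasSum_re (hasSum_laplace_exp_rpow ha ha1 hb hb1 hx t t)
  refine h.summable.congr fun i => ?_
  rw [← pow_add]
  norm_cast

end TwoTerms

/-! ### Multiplication formula and residue classes -/

lemma Gamma_add_natCast {c : ℝ} (hc : 0 < c) (N : ℕ) :
    Gamma (c + N) = Gamma c * ∏ i ∈ Finset.range N, (c + i) := by
  induction N with
  | zero => simp
  | succ N ih =>
    have h : (0 : ℝ) < c + N := by positivity
    rw [Nat.cast_succ, ← add_assoc, Gamma_add_one h.ne', ih, Finset.prod_range_succ]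
    ring

lemma prod_map_deltaList (f : ℝ → ℝ) (N : ℕ) (c : ℝ) :
    ((deltaList N c).map f).prod = ∏ i ∈ Finset.range N, f ((c + i) / N) := by
  -- In `deltaList` the index is a real number, so the list of naturals appears there under a
  -- monadic coercion; this rewrites it as a map.
  have h : (do let a ← List.range N; pure (a : ℝ)) = (List.range N).map fun a : ℕ => (a : ℝ) :=
    List.flatMap_pure_eq_map _ _
  rw [deltaList, h, List.map_map, List.map_map]
  rfl

lemma poch_succ (c : ℝ) (j : ℕ) : poch c (j + 1) = poch c j * (c + j) := by
  rw [poch, ascPochhammer_succ_eval, poch]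

lemma prod_poch_deltaList_pos {c : ℝ} (hc : 0 < c) (N j : ℕ) :
    0 < ((deltaList N c).map fun a => poch a j).prod := by
  rw [prod_map_deltaList]
  refine Finset.prod_pos fun i hi => ascPochhammer_pos j _ ?_
  have hN : 0 < N := (Nat.zero_le i).trans_lt (Finset.mem_range.1 hi)
  positivity

/-- The Gauss multiplication rule for Pochhammer symbols. -/
lemma Gamma_add_mul_natCast {c : ℝ} (hc : 0 < c) {N : ℕ} (hN : 0 < N) (j : ℕ) :
    Gamma (c + N * j) =
      Gamma c * (((N : ℝ) ^ N) ^ j * ((deltaList N c).map fun a => poch a j).prod) := by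
  rw [prod_map_deltaList]
  induction j with
  | zero => simp [poch]
  | succ j ih =>
    have h : (0 : ℝ) < c + N * j := by positivity
    have hN' : (N : ℝ) ≠ 0 := by positivity
    have e : ∏ i ∈ Finset.range N, (c + N * j + i) =
        (N : ℝ) ^ N * ∏ i ∈ Finset.range N, ((c + i) / N + j) := by
      rw [← Finset.card_range N, ← Finset.prod_const, Finset.card_range, ← Finset.prod_mul_distrib]
      refine Finset.prod_congr rfl fun i _ => ?_
      field_simp
      ring
    have e2 : c + N * ((j + 1 : ℕ) : ℝ) = c + N * j + N := by push_cast; ring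
    rw [e2, Gamma_add_natCast h, ih, e]
    simp only [poch_succ, Finset.prod_mul_distrib, pow_succ]
    ring

lemma factorial_add_mul {m : ℕ} (hm : 0 < m) (n j : ℕ) :
    ((n + m * j).factorial : ℝ) =
      n.factorial * (((m : ℝ) ^ m) ^ j * ((deltaList m (1 + n)).map fun a => poch a j).prod) := by
  have h := Gamma_add_mul_natCast (c := 1 + n) (by positivity) hm j
  have e : (1 + n + m * j : ℝ) = ((n + m * j : ℕ) : ℝ) + 1 := by push_cast; ring
  rwa [e, Gamma_nat_eq_factorial, add_comm (1 : ℝ), Gamma_nat_eq_factorial, add_comm (n : ℝ)] at h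

/-- Summation over residue classes. -/
lemma hasSum_of_residues {f : ℕ → ℝ} {m : ℕ} (hm : 0 < m) {g : ℕ → ℝ}
    (h : ∀ n < m, HasSum (fun j => f (n + m * j)) (g n)) :
    HasSum f (∑ n ∈ Finset.range m, g n) := by
  -- Each class is extended by zero to all of `ℕ`; the finitely many extensions add up to `f`.
  have h1 : ∀ n ∈ Finset.range m, HasSum (fun k => if k % m = n then f k else 0) (g n) := by
    intro n hn
    have hn := Finset.mem_range.1 hn
    have hinj : Function.Injective fun j => n + m * j := fun i j hij =>
      Nat.eq_of_mul_eq_mul_left hm (Nat.add_left_cancel hij)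
    refine (hinj.hasSum_iff fun k hk => if_neg fun hkn => hk ⟨k / m, ?_⟩).1 ?_
    · simp only
      rw [← hkn]
      exact Nat.mod_add_div k m
    · simpa [Function.comp_def, Nat.mod_eq_of_lt hn] using h n hn
  refine Eq.mpr (congrArg (fun f : ℕ → ℝ => HasSum f _) (funext fun k => ?_)) (hasSum_sum h1)
  rw [Finset.sum_ite_eq, if_pos (Finset.mem_range.2 (Nat.mod_lt k hm))]

/-! ### Regrouping into hypergeometric series -/

/-- The modulus `t^(n+r) / (n! r!) · Γ(1 + Mn + mr) / x^(1 + Mn + mr)` of the terms of the double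
series, without the sine. -/
noncomputable def gammaTerm (M m t x : ℝ) (n r : ℕ) : ℝ :=
  t ^ (n + r) / ((n.factorial : ℝ) * (r.factorial : ℝ)) *
    (Gamma (1 + M * n + m * r) / x ^ (1 + M * n + m * r))

section Regroup

variable {M m t x : ℝ} {N m₁ : ℕ}

lemma gammaTerm_pos (hM : 0 < M) (hm : 0 < m) (ht : 0 < t) (hx : 0 < x) (n r : ℕ) :
    0 < gammaTerm M m t x n r := by
  have : 0 < Gamma (1 + M * n + m * r) := Gamma_pos_of_pos (by positivity)
  unfold gammaTerm
  positivity

/-- Because `M m₁ = N`, the Gamma argument moves by the integer `N j` while the factorial moves by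
`m₁ j`. The multiplication formula applies to both, and the leftover powers form `κ^j`. -/
lemma gammaTerm_add_mul (hM : 0 < M) (hm : 0 < m) (hx : 0 < x) (hN : 0 < N) (hm₁ : 0 < m₁)
    (hMN : M * m₁ = N) (n r j : ℕ) :
    gammaTerm M m t x (n + m₁ * j) r = gammaTerm M m t x n r *
      (((N : ℝ) ^ N / (m₁ : ℝ) ^ m₁ * (t ^ m₁ / x ^ N)) ^ j *
        (((deltaList N (1 + M * n + m * r)).map fun a => poch a j).prod /
          ((deltaList m₁ (1 + n)).map fun a => poch a j).prod)) := by
  have hc : 0 < 1 + M * n + m * r := by positivity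
  have hL := prod_poch_deltaList_pos (c := 1 + n) (by positivity) m₁ j
  have e : 1 + M * ((n + m₁ * j : ℕ) : ℝ) + m * r = 1 + M * n + m * r + N * j := by
    rw [← hMN]
    push_cast
    ring
  have ex : x ^ (1 + M * n + m * r + N * j) = x ^ (1 + M * n + m * r) * (x ^ N) ^ j := by
    rw [rpow_add hx, ← Nat.cast_mul, rpow_natCast, pow_mul]
  have et : t ^ (n + m₁ * j + r) = t ^ (n + r) * (t ^ m₁) ^ j := by
    rw [← pow_mul, ← pow_add]
    ring_nf
  have hxc := rpow_pos_of_pos hx (1 + M * n + m * r)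
  rw [gammaTerm, gammaTerm, e, Gamma_add_mul_natCast hc hN, factorial_add_mul hm₁, ex, et]
  have hm₁' : (0 : ℝ) < m₁ := by exact_mod_cast hm₁
  rw [mul_pow, div_pow, div_pow]
  field_simp

/-- The upper parameter 1 contributes `(1)_j = j!`, cancelling the factorial of the series. -/
lemma hypTerm_one_cons (us ls : List ℝ) (z : ℝ) (j : ℕ) :
    hypTerm (1 :: us) ls z j =
      z ^ j * ((us.map fun a => poch a j).prod / (ls.map fun b => poch b j).prod) := by
  have h1 : poch 1 j = (j.factorial : ℝ) := by rw [poch, ascPochhammer_eval_one]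
  have hj : (j.factorial : ℝ) ≠ 0 := by positivity
  rw [hypTerm, List.map_cons, List.prod_cons, h1]
  field_simp

lemma abs_hypTerm_eq (hM : 0 < M) (hm : 0 < m) (e n r j : ℕ) {κ : ℝ} (hκ : 0 ≤ κ) :
    |hypTerm (1 :: deltaList N (1 + M * n + m * r)) (deltaList m₁ (1 + n)) ((-1) ^ e * κ) j| =
      κ ^ j * (((deltaList N (1 + M * n + m * r)).map fun a => poch a j).prod /
          ((deltaList m₁ (1 + n)).map fun a => poch a j).prod) := by
  have hU := prod_poch_deltaList_pos (c := 1 + M * n + m * r) (by positivity) N j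
  have hL := prod_poch_deltaList_pos (c := 1 + n) (by positivity) m₁ j
  rw [hypTerm_one_cons, abs_mul, abs_pow, abs_mul, abs_pow, abs_neg, abs_one, one_pow, one_mul,
    abs_of_nonneg hκ, abs_of_pos (div_pos hU hL)]

/-- The `(n, r)` term of the double series of the two-scale density. -/
noncomputable def doubleTerm (M m t x : ℝ) (n r : ℕ) : ℝ :=
  -(1 / π) * ((-t) ^ (n + r) / ((n.factorial : ℝ) * (r.factorial : ℝ)) *
    (Gamma (1 + M * n + m * r) / x ^ (1 + M * n + m * r)) * sin (π * M * n + π * m * r))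

lemma doubleTerm_eq (n r : ℕ) : doubleTerm M m t x n r =
    -(1 / π) * ((-1) ^ (n + r) * gammaTerm M m t x n r * sin (π * M * n + π * m * r)) := by
  rw [doubleTerm, gammaTerm, neg_pow]
  ring

lemma abs_doubleTerm_le (hM : 0 < M) (hm : 0 < m) (ht : 0 < t) (hx : 0 < x) (n r : ℕ) :
    |doubleTerm M m t x n r| ≤ gammaTerm M m t x n r := by
  have hg := gammaTerm_pos hM hm ht hx n r
  rw [doubleTerm_eq, abs_mul, abs_mul, abs_mul, abs_neg, abs_pow, abs_neg, abs_one, one_pow,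
    one_mul, abs_of_pos hg, abs_of_pos (by positivity : 0 < 1 / π)]
  have h1 : 1 / π ≤ 1 := by
    rw [div_le_one pi_pos]
    linarith [pi_gt_three]
  have h2 := mul_le_of_le_one_right hg.le (abs_sin_le_one (π * M * n + π * m * r))
  exact (mul_le_of_le_one_left (by positivity) h1).trans h2

/-- Only signs are new compared with `gammaTerm_add_mul`: the power of `-t` gives `(-1)^{m₁ j}`, the
sine, shifted by `π N j`, gives `(-1)^{N j}`, and together they are `((-1)^{m₁ - N})^j`. -/
lemma doubleTerm_add_mul (hM : 0 < M) (hm : 0 < m) (hx : 0 < x) (hN : 0 < N) (hm₁ : N < m₁)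
    (hMN : M * m₁ = N) (n r j : ℕ) :
    doubleTerm M m t x (n + m₁ * j) r = doubleTerm M m t x n r *
      hypTerm (1 :: deltaList N (1 + M * n + m * r)) (deltaList m₁ (1 + n))
        ((-1) ^ (m₁ - N) * ((N : ℝ) ^ N / (m₁ : ℝ) ^ m₁ * (t ^ m₁ / x ^ N))) j := by
  have hs : sin (π * M * ((n + m₁ * j : ℕ) : ℝ) + π * m * r) =
      (-1) ^ (N * j) * sin (π * M * n + π * m * r) := by
    rw [← sin_add_nat_mul_pi]
    congr 1
    push_cast
    rw [← hMN]
    ring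
  have hsgn : (-1 : ℝ) ^ (n + m₁ * j + r) * (-1) ^ (N * j) =
      (-1) ^ (n + r) * ((-1) ^ (m₁ - N)) ^ j := by
    obtain ⟨d, rfl⟩ := Nat.exists_eq_add_of_le hm₁.le
    have h1 : (-1 : ℝ) ^ (N * j) * (-1) ^ (N * j) = 1 := by
      rw [← mul_pow]
      simp
    rw [Nat.add_sub_cancel_left, ← pow_mul]
    calc (-1 : ℝ) ^ (n + (N + d) * j + r) * (-1) ^ (N * j)
        = (-1) ^ (n + r) * (-1) ^ (d * j) * ((-1) ^ (N * j) * (-1) ^ (N * j)) := by ring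
      _ = _ := by rw [h1, mul_one]
  rw [doubleTerm_eq, doubleTerm_eq, gammaTerm_add_mul hM hm hx hN (hN.trans hm₁) hMN, hs,
    hypTerm_one_cons, mul_pow _ (_ * _) j]
  linear_combination (-(1 / π) * gammaTerm M m t x n r *
      (((N : ℝ) ^ N / (m₁ : ℝ) ^ m₁ * (t ^ m₁ / x ^ N)) ^ j *
        (((deltaList N (1 + M * n + m * r)).map fun a => poch a j).prod /
          ((deltaList m₁ (1 + n)).map fun a => poch a j).prod)) *
      sin (π * M * n + π * m * r)) * hsgn

/-- The regrouping of the double series into hypergeometric series along residue classes. -/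
lemma hypergeometric_expansion (hM : 0 < M) (hM1 : M < 1) (hm : 0 < m) (hm1 : m < 1) (ht : 0 < t)
    (hx : 0 < x) (hN : 0 < N) (hm₁ : N < m₁) (hMN : M * m₁ = N) {us : ℕ → ℕ → List ℝ}
    {ls : ℕ → List ℝ} {z : ℝ}
    (hus : ∀ r n, us r n = 1 :: deltaList N (1 + M * n + m * r))
    (hls : ∀ n, ls n = deltaList m₁ (1 + n))
    (hz : z = (-1) ^ (m₁ - N) * ((N : ℝ) ^ N / (m₁ : ℝ) ^ m₁ * (t ^ m₁ / x ^ N))) :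
    (∀ r n : ℕ, Summable fun j => |hypTerm (us r n) (ls n) z j|) ∧
    (Summable fun r : ℕ => ∑ n ∈ Finset.range m₁,
      |doubleTerm M m t x n r * hyp (us r n) (ls n) z|) ∧
    HasSum (fun r : ℕ => ∑ n ∈ Finset.range m₁, doubleTerm M m t x n r * hyp (us r n) (ls n) z)
      (twoScaleDensity M m t x) := by
  have hm₁0 : 0 < m₁ := hN.trans hm₁
  have hκ : 0 ≤ (N : ℝ) ^ N / (m₁ : ℝ) ^ m₁ * (t ^ m₁ / x ^ N) := by positivity
  have hG : Summable fun i : ℕ × ℕ => gammaTerm M m t x i.1 i.2 :=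
    summable_gamma_double hM hM1 hm hm1 hx
  have hD : HasSum (fun i : ℕ × ℕ => doubleTerm M m t x i.1 i.2) (twoScaleDensity M m t x) :=
    hasSum_twoScaleDensity hM hM1 hm hm1 ht hx
  have hterm (r n j : ℕ) : gammaTerm M m t x (n + m₁ * j) r =
      gammaTerm M m t x n r * |hypTerm (us r n) (ls n) z j| := by
    rw [gammaTerm_add_mul hM hm hx hN hm₁0 hMN, hus, hls, hz, abs_hypTerm_eq hM hm _ _ _ _ hκ]
  -- No ratio test is needed: up to a positive factor this is a subfamily of the summable double
  -- series.
  have habs (r n : ℕ) : Summable fun j => |hypTerm (us r n) (ls n) z j| := by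
    have hinj : Function.Injective fun j => ((n + m₁ * j, r) : ℕ × ℕ) := fun i j hij =>
      Nat.eq_of_mul_eq_mul_left hm₁0 (Nat.add_left_cancel (Prod.ext_iff.1 hij).1)
    have h := hG.comp_injective hinj
    simp only [Function.comp_def, hterm] at h
    exact (summable_mul_left_iff (gammaTerm_pos hM hm ht hx n r).ne').1 h
  have hinner (r : ℕ) : HasSum (fun n => gammaTerm M m t x n r)
      (∑ n ∈ Finset.range m₁, gammaTerm M m t x n r * ∑' j, |hypTerm (us r n) (ls n) z j|) := by
    refine hasSum_of_residues hm₁0 fun n _ => ?_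
    simp only [hterm]
    exact (habs r n).hasSum.mul_left _
  have hinnerD (r : ℕ) : HasSum (fun n => doubleTerm M m t x n r)
      (∑ n ∈ Finset.range m₁, doubleTerm M m t x n r * hyp (us r n) (ls n) z) := by
    refine hasSum_of_residues hm₁0 fun n _ => ?_
    simp only [doubleTerm_add_mul hM hm hx hN hm₁ hMN]
    rw [hus, hls, hz]
    have h := (habs r n).of_abs
    rw [hus, hls, hz] at h
    exact h.hasSum.mul_left _
  refine ⟨habs, ?_, ?_⟩
  · have hG' : HasSum (fun i : ℕ × ℕ => gammaTerm M m t x i.2 i.1) _ :=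
      (Equiv.prodComm ℕ ℕ).hasSum_iff.2 hG.hasSum
    have h := hG'.prod_fiberwise (g := fun r => ∑ n ∈ Finset.range m₁,
      gammaTerm M m t x n r * ∑' j, |hypTerm (us r n) (ls n) z j|) hinner
    refine h.summable.of_nonneg_of_le (fun r => Finset.sum_nonneg fun n _ => abs_nonneg _)
      fun r => Finset.sum_le_sum fun n _ => ?_
    rw [abs_mul]
    refine mul_le_mul (abs_doubleTerm_le hM hm ht hx n r) ?_ (abs_nonneg _)
      (gammaTerm_pos hM hm ht hx n r).le
    rw [hyp, ← Real.norm_eq_abs]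
    exact norm_tsum_le_tsum_norm (f := fun j => hypTerm (us r n) (ls n) z j) (habs r n)
  · have hD' : HasSum (fun i : ℕ × ℕ => doubleTerm M m t x i.2 i.1) (twoScaleDensity M m t x) :=
      (Equiv.prodComm ℕ ℕ).hasSum_iff.2 hD
    exact hD'.prod_fiberwise hinnerD

end Regroup

/-! ### Behaviour near the origin -/

lemma twoScaleDensity_comm (a b t x : ℝ) : twoScaleDensity a b t x = twoScaleDensity b a t x := by
  rw [twoScaleDensity, twoScaleDensity]
  have h := intervalIntegral.integral_comp_sub_left (a := 0) (b := x)
    (fun y => oneSidedDensity a t y * oneSidedDensity b t (x - y)) x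
  simp only [sub_sub_cancel, sub_self, sub_zero] at h
  rw [← h]
  simp only [mul_comm]

/-- Chernoff-type bounds for the two-scale density. -/
lemma exists_abs_twoScaleDensity_le {M m t : ℝ} (hM : 0 < M) (hM1 : M < 1) (hm : 0 < m)
    (hm1 : m < 1) (ht : 0 < t) :
    ∃ K : ℝ, 0 ≤ K ∧ ∀ x s : ℝ, 0 < x → 0 ≤ s →
      |twoScaleDensity M m t x| ≤ K * exp (s * x - t * s ^ M) := by
  -- The smaller index `m` of the application pays for integrability, leaving `M` for the decay in
  -- `s`; hence the exchange of the two indices below.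
  refine ⟨1 / (2 * π) * ∫ ω : ℝ, exp (-(t * cos (π / 2 * m)) * |ω| ^ m), ?_, fun x s hx hs => ?_⟩
  · exact mul_nonneg (by positivity) (integral_nonneg fun ω => (exp_pos _).le)
  · have h := congrArg norm (ofReal_twoScaleDensity hm hm1 hM hM1 ht hx)
    have hpi : (1 / (2 * π) : ℂ) = ((1 / (2 * π) : ℝ) : ℂ) := by push_cast; rfl
    rw [Complex.norm_real, norm_mul, hpi, Complex.norm_real,
      Real.norm_of_nonneg (by positivity : 0 ≤ 1 / (2 * π)),
      ← bromwich_eq_bromwich_zero hm hm1 hM hM1 ht ht.le hs] at h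
    rw [twoScaleDensity_comm, ← Real.norm_eq_abs, h, mul_assoc, mul_comm (integral _ _)]
    gcongr
    exact norm_bromwich_le hm hm1 hM hM1 ht ht.le hs x

/-- The unoptimized choice `s = 1/x` already makes the exponent `1 - t x^{-M}`, which tends to `-∞`.
-/
lemma tendsto_twoScaleDensity_zero {M m t : ℝ} (hM : 0 < M) (hM1 : M < 1) (hm : 0 < m)
    (hm1 : m < 1) (ht : 0 < t) :
    Tendsto (fun x => twoScaleDensity M m t x) (𝓝[>] 0) (𝓝 0) := by
  obtain ⟨K, -, hK⟩ := exists_abs_twoScaleDensity_le hM hM1 hm hm1 ht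
  have h1 : Tendsto (fun x : ℝ => t * x⁻¹ ^ M) (𝓝[>] 0) atTop :=
    ((tendsto_rpow_atTop hM).comp tendsto_inv_nhdsGT_zero).const_mul_atTop ht
  have h2 : Tendsto (fun x : ℝ => K * exp (1 - t * x⁻¹ ^ M)) (𝓝[>] 0) (𝓝 0) := by
    have h3 := (tendsto_exp_neg_atTop_nhds_zero.comp h1).const_mul (K * exp 1)
    rw [mul_zero] at h3
    refine h3.congr fun x => ?_
    rw [Function.comp_apply, mul_assoc, ← exp_add, ← sub_eq_add_neg]
  refine squeeze_zero_norm' ?_ h2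
  filter_upwards [self_mem_nhdsWithin] with x hx
  have hx : 0 < x := hx
  have h := hK x x⁻¹ hx (by positivity)
  rwa [inv_mul_cancel₀ hx.ne'] at h

/-- The Legendre transform in the Chernoff bound at its optimal point. -/
lemma exists_chernoff_exponent {M t x κ : ℝ} {N m₁ : ℕ} (hN : 0 < N) (hm₁ : N < m₁)
    (hMN : M * m₁ = N) (ht : 0 < t) (hx : 0 < x)
    (hκ : κ = (N : ℝ) ^ N / (m₁ : ℝ) ^ m₁ * (t ^ m₁ / x ^ N)) :
    ∃ s : ℝ, 0 ≤ s ∧ s * x - t * s ^ M = -(((m₁ : ℝ) - N) * κ ^ (1 / ((m₁ : ℝ) - N))) := by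
  have hm₁0 : (0 : ℝ) < m₁ := by exact_mod_cast hN.trans hm₁
  have hN0 : (0 : ℝ) < N := by exact_mod_cast hN
  obtain ⟨d, rfl⟩ := Nat.exists_eq_add_of_lt hm₁
  have hd : (((N + d + 1 : ℕ) : ℝ) - N) = ((d + 1 : ℕ) : ℝ) := by push_cast; ring
  rw [hd]
  have hκ0 : 0 < κ := by rw [hκ]; positivity
  set y : ℝ := κ ^ (1 / ((d + 1 : ℕ) : ℝ)) with hy
  have hy0 : 0 < y := rpow_pos_of_pos hκ0 _
  have hyκ : y ^ (d + 1) = κ := by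
    rw [hy, one_div, rpow_inv_natCast_pow hκ0.le (Nat.succ_ne_zero d)]
  -- The critical point of `s x - t s^M`: there `s x = M t s^M`, that is, `s x = N y` and `t s^M =
  -- m₁ y`.
  set s : ℝ := N * y / x with hs
  have hs0 : 0 < s := by positivity
  refine ⟨s, hs0.le, ?_⟩
  have key : t * s ^ M = ((N + d + 1 : ℕ) : ℝ) * y := by
    -- Comparing `m₁`-th powers removes the fractional exponent, since `(s^M)^{m₁} = s^N`.
    refine (pow_left_inj₀ (by positivity) (by positivity) (Nat.succ_ne_zero (N + d))).1 ?_
    have e1 : (s ^ M) ^ (N + d + 1) = s ^ N := by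
      rw [← rpow_natCast, ← rpow_mul hs0.le, hMN, rpow_natCast]
    have e2 : y ^ (N + d + 1) = y ^ N * κ := by rw [← hyκ]; ring
    rw [Nat.succ_eq_add_one, mul_pow, mul_pow, e1, e2, hκ, hs, div_pow, mul_pow]
    field_simp
  rw [key, hs]
  push_cast
  field_simp
  ring

/-! ### The parameters `l`, `k`, `p`, `q` -/

section Parameters

variable {l k p q : ℕ}

/-- Cross-multiplying, the larger fraction is paired with the smaller of `kp` and `lq`, and its
denominator cancels. -/
lemma mMax_mul_mOne (hl : 0 < l) (hk : 0 < k) (hp : 0 < p) (hq : 0 < q) :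
    mMax l k p q * mOne l k p q = ((l * p : ℕ) : ℝ) := by
  have hk' : (0 : ℝ) < k := by exact_mod_cast hk
  have hq' : (0 : ℝ) < q := by exact_mod_cast hq
  rcases le_total ((l : ℝ) / k) ((p : ℝ) / q) with h | h
  · have h1 : l * q ≤ k * p := by
      rw [div_le_div_iff₀ hk' hq'] at h
      rw [mul_comm k p]
      exact_mod_cast h
    rw [mMax, mOne, max_eq_right h, min_eq_right h1]
    push_cast
    field_simp
  · have h1 : k * p ≤ l * q := by
      rw [div_le_div_iff₀ hq' hk'] at h
      rw [mul_comm k p]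
      exact_mod_cast h
    rw [mMax, mOne, max_eq_left h, min_eq_left h1]
    push_cast
    field_simp

lemma twoScaleDensity_max_min (t x : ℝ) :
    twoScaleDensity ((l : ℝ) / k) ((p : ℝ) / q) t x =
      twoScaleDensity (mMax l k p q) (mMin l k p q) t x := by
  rcases le_total ((l : ℝ) / k) ((p : ℝ) / q) with h | h
  · rw [mMax, mMin, max_eq_right h, min_eq_left h, twoScaleDensity_comm]
  · rw [mMax, mMin, max_eq_left h, min_eq_right h]

lemma kappa_eq {t x : ℝ} (hM : 0 < mMax l k p q)
    (hMN : mMax l k p q * mOne l k p q = ((l * p : ℕ) : ℝ)) (ht : 0 < t) :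
    kappa l k p q t x = ((l * p : ℕ) : ℝ) ^ (l * p) / (mOne l k p q : ℝ) ^ mOne l k p q *
      (t ^ mOne l k p q / x ^ (l * p)) := by
  have e : (t ^ (1 / mMax l k p q)) ^ (l * p) = t ^ mOne l k p q := by
    rw [← rpow_natCast (t ^ (1 / mMax l k p q)), ← rpow_mul ht.le, ← hMN, one_div,
      inv_mul_cancel_left₀ hM.ne', rpow_natCast]
  rw [kappa, div_pow, e]

lemma tendsto_kappa_atTop {t : ℝ} (ht : 0 < t) (hlp : 0 < l * p) (hm : 0 < mOne l k p q) :
    Tendsto (fun x => kappa l k p q t x) (𝓝[>] 0) atTop := by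
  have h1 : Tendsto (fun x : ℝ => t ^ (1 / mMax l k p q) / x) (𝓝[>] 0) atTop := by
    simpa only [div_eq_mul_inv] using
      tendsto_inv_nhdsGT_zero.const_mul_atTop (rpow_pos_of_pos ht (1 / mMax l k p q))
  have hm' : (0 : ℝ) < mOne l k p q := by exact_mod_cast hm
  have hlp' : (0 : ℝ) < ((l * p : ℕ) : ℝ) := by exact_mod_cast hlp
  exact ((tendsto_pow_atTop hlp.ne').comp h1).const_mul_atTop (by positivity)

lemma seriesTerm_eq (t x : ℝ) (r n : ℕ) :
    seriesTerm l k p q t x r n = doubleTerm (mMax l k p q) (mMin l k p q) t x n r *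
      hyp (upperParams l k p q r n) (lowerParams l k p q n) (hypArg l k p q t x) := by
  rw [seriesTerm, doubleTerm]
  ring

end Parameters

end

end TwoScale

/-! ### The theorem -/

theorem mainTheorem7 (l k p q : ℕ) (hl : 0 < l) (hlk : l < k) (hp : 0 < p) (hpq : p < q)
    (hne : (l : ℝ) / k ≠ (p : ℝ) / q) (t : ℝ) (ht : 0 < t) :
    -- for `x > 0`: absolute convergence of every hypergeometric series that occurs, absolute
    -- convergence of the double series, its sum, and the resulting estimate of `|h|`
    (∀ x : ℝ, 0 < x →
      (∀ r n : ℕ, n < TwoScale.mOne l k p q →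
        Summable fun j : ℕ => |TwoScale.hypTerm (TwoScale.upperParams l k p q r n)
          (TwoScale.lowerParams l k p q n) (TwoScale.hypArg l k p q t x) j|) ∧
      (Summable fun r : ℕ =>
        ∑ n ∈ Finset.range (TwoScale.mOne l k p q), |TwoScale.seriesTerm l k p q t x r n|) ∧
      HasSum (fun r : ℕ =>
        ∑ n ∈ Finset.range (TwoScale.mOne l k p q), TwoScale.seriesTerm l k p q t x r n)
        (TwoScale.twoScaleDensity ((l : ℝ) / k) ((p : ℝ) / q) t x) ∧
      |TwoScale.twoScaleDensity ((l : ℝ) / k) ((p : ℝ) / q) t x| ≤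
        ∑' r : ℕ, ∑ n ∈ Finset.range (TwoScale.mOne l k p q),
          |TwoScale.seriesTerm l k p q t x r n|) ∧
    -- the exponential estimate as `x → 0+`
    (0 < (TwoScale.mOne l k p q : ℝ) - (l * p : ℕ) ∧
      ∃ B : ℝ, 0 < B ∧ ∀ᶠ x : ℝ in nhdsWithin 0 (Set.Ioi 0),
        |TwoScale.twoScaleDensity ((l : ℝ) / k) ((p : ℝ) / q) t x| <
          B * TwoScale.kappa l k p q t x ^ (5 / 2 : ℝ) *
            Real.exp (-(((TwoScale.mOne l k p q : ℝ) - (l * p : ℕ)) *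
              TwoScale.kappa l k p q t x ^
                (1 / ((TwoScale.mOne l k p q : ℝ) - (l * p : ℕ)))))) ∧
    -- the limit at the origin
    Filter.Tendsto (fun x : ℝ => TwoScale.twoScaleDensity ((l : ℝ) / k) ((p : ℝ) / q) t x)
      (nhdsWithin 0 (Set.Ioi 0)) (nhds 0) := by
  have hk : 0 < k := hl.trans hlk
  have hq : 0 < q := hp.trans hpq
  have hk' : (0 : ℝ) < k := by exact_mod_cast hk
  have hq' : (0 : ℝ) < q := by exact_mod_cast hq
  have hl' : (0 : ℝ) < l := by exact_mod_cast hl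
  have hp' : (0 : ℝ) < p := by exact_mod_cast hp
  have hlk1 : (l : ℝ) / k < 1 := (div_lt_one hk').2 (by exact_mod_cast hlk)
  have hpq1 : (p : ℝ) / q < 1 := (div_lt_one hq').2 (by exact_mod_cast hpq)
  have hM : 0 < TwoScale.mMax l k p q := lt_max_of_lt_left (by positivity)
  have hM1 : TwoScale.mMax l k p q < 1 := max_lt hlk1 hpq1
  have hm : 0 < TwoScale.mMin l k p q := lt_min (by positivity) (by positivity)
  have hm1 : TwoScale.mMin l k p q < 1 := min_lt_of_left_lt hlk1
  have hN : 0 < l * p := Nat.mul_pos hl hp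
  have hlt : l * p < TwoScale.mOne l k p q :=
    lt_min (Nat.mul_lt_mul_of_pos_right hlk hp) (Nat.mul_lt_mul_of_pos_left hpq hl)
  have hMN := TwoScale.mMax_mul_mOne hl hk hp hq
  simp only [TwoScale.twoScaleDensity_max_min]
  refine ⟨fun x hx => ?_, ⟨sub_pos.2 (by exact_mod_cast hlt), ?_⟩,
    TwoScale.tendsto_twoScaleDensity_zero hM hM1 hm hm1 ht⟩
  · obtain ⟨h1, h2, h3⟩ := TwoScale.hypergeometric_expansion hM hM1 hm hm1 ht hx hN hlt hMN
      (us := TwoScale.upperParams l k p q) (ls := TwoScale.lowerParams l k p q)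
      (z := TwoScale.hypArg l k p q t x) (fun _ _ => rfl) (fun _ => rfl)
      (by rw [TwoScale.hypArg, TwoScale.kappa_eq hM hMN ht])
    simp only [← TwoScale.seriesTerm_eq] at h2 h3
    refine ⟨fun r n _ => h1 r n, h2, h3, ?_⟩
    rw [← h3.tsum_eq, ← Real.norm_eq_abs]
    refine tsum_of_norm_bounded h2.hasSum fun r => ?_
    rw [Real.norm_eq_abs]
    exact Finset.abs_sum_le_sum_abs _ _
  · obtain ⟨K, hK0, hK⟩ := TwoScale.exists_abs_twoScaleDensity_le hM hM1 hm hm1 ht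
    -- Adding 1 makes the constant positive and the inequality strict; the factor `κ^{5/2}` is at
    -- least 1 once `κ ≥ 1`.
    refine ⟨K + 1, by linarith, ?_⟩
    filter_upwards [self_mem_nhdsWithin, (TwoScale.tendsto_kappa_atTop ht hN
      (hN.trans hlt)).eventually_ge_atTop 1] with x hx hκ
    obtain ⟨s, hs, hse⟩ := TwoScale.exists_chernoff_exponent hN hlt hMN ht hx
      (TwoScale.kappa_eq hM hMN ht)
    rw [← hse]
    refine (hK x s hx hs).trans_lt (mul_lt_mul_of_pos_right ?_ (Real.exp_pos _))
    have h1 : 1 ≤ TwoScale.kappa l k p q t x ^ (5 / 2 : ℝ) :=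
      Real.one_le_rpow hκ (by norm_num)
    nlinarith
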